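/- Let $\mathbb K$ be a good topological ring: a Hausdorff topological ring (with unit, not necessarily commutative) whose unit group $\mathbb K^\times$ is dense in $\mathbb K$. All topological $\mathbb K$-modules are Hausdorff. For a subset $U$ of a $\mathbb K$-module $V$ put $U^{[1]}=\{(x,v,t)\in V\times V\times\mathbb K: x\in U,\ x+tv\in U\}$, and let $U^{\{1\}}=(U^{[1]},U\times\mathbb K)$ be the groupoid with source $\alpha(x,v,t)=(x,t)$, target $\beta(x,v,t)=(x+tv,t)$, units $1_{(x,t)}=(x,0,t)$, product $(x+tv,v',t)*(x,v,t)=(x,v'+v,t)$ and inverse $(x,v,t)^{-1}=(x+tv,-v,t)$. A map $f:U\to W$ from an open set $U\subset V$ to a topological $\mathbb K$-module $W$ is $C^1$ if there is a continuous map $f^{[1]}:U^{[1]}\to W$ with $f^{[1]}(x,v,t)=t^{-1}(f(x+tv)-f(x))$ for all $t\in\mathbb K^\times$. A *Hausdorff manifold* over $\mathbb K$ is a Hausdorff space with an atlas of charts onto open subsets of a topological $\mathbb K$-module, all of whose transition maps are $C^1$; if $\mathbb K$ is not a topological (skew) field, the atlas is moreover required to be such that any finitely many points lie in the domain of one of its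 charts. A map $f:M\to N$ between manifolds is *smooth* if it is continuous and $C^1$ in all pairs of charts of the two atlases. The tangent bundle $TM$ consists of the tangent vectors of $M$, given by their components in charts, which transform by $v\mapsto d\varphi(x)v=\varphi^{[1]}(x,v,0)$ under transition maps $\varphi$; it is a bundle of abelian groups over $M$, hence a groupoid with $\alpha=\beta$. The pair groupoid $\mathsf{PG}(M)$ has morphisms $(y,x):x\to y$, $x,y\in M$. **Theorem.** One can assign to every Hausdorff manifold $M$ over $\mathbb K$ a topological groupoid $M^{\{1\}}=(M^{[1]},M\times\mathbb K)$, in which source and target of each morphism have the same component in $\mathbb K$, such that: 1. For each chart $\varphi$ of the atlas, with domain $D\subset M$ and image $U$, there is a functor $\iota_\varphi:U^{\{1\}}\to M^{\{1\}}$ given on objects by $\varphi^{-1}\times\mathrm{id}_{\mathbb K}$ and on morphisms by a homeomorphism from $U^{[1]}$ onto an open subset of $M^{[1]}$, namely the set of all morphisms with source and target in $D\times\mathbb K$. If $M=U$ is an open subset of a topological $\mathbb K$-module, with the inclusion as its chart, then $M^{\{1\}}$ is isomorphic to $U^{\{1\}}$ as a topological groupoid over $U\times\mathbb K$. 2. A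 map $f:M\to N$ between Hausdorff manifolds is smooth if and only if there is a continuous functor $f^{\{1\}}:M^{\{1\}}\to N^{\{1\}}$ that is $f\times\mathrm{id}_{\mathbb K}$ on objects; such a functor is unique. Thus smooth maps $M\to N$ correspond bijectively to the continuous functors $M^{\{1\}}\to N^{\{1\}}$ whose map on objects has the form $f\times\mathrm{id}_{\mathbb K}$. 3. For $t\in\mathbb K$ let $M^{\{1\}}_t=(M_t,M)$ be the groupoid of all morphisms of $M^{\{1\}}$ between objects of $M\times\{t\}$. As a topological groupoid over $M$ it is isomorphic to $\mathsf{PG}(M)$ if $t\in\mathbb K^\times$, and to $TM$ if $t=0$. 4. The group $\mathbb K^\times$ acts on $M^{\{1\}}$ by continuous automorphisms $\Phi_s$, given on objects by $\Phi_s(x,t)=(x,ts^{-1})$ and in charts by $\Phi_s(\iota_\varphi(x,v,t))=\iota_\varphi(x,sv,ts^{-1})$. One has $f^{\{1\}}\circ\Phi_s=\Phi_s\circ f^{\{1\}}$ for all smooth maps $f:M\to N$ and all $s\in\mathbb K^\times$. -/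

import Mathlib

open Set Filter Topology

universe u w

namespace LieCalc

set_option linter.unusedSectionVars false

/-! ### Groupoids -/

/-- A groupoid with set of morphisms `A` and set of objects `X`.  The product `mul a b`
is defined when the source of `a` is the target of `b`. -/
structure Grpd (A : Type*) (X : Type*) where
  src : A → X
  tgt : A → X
  mul : ∀ a b : A, src a = tgt b → A
  src_mul : ∀ a b h, src (mul a b h) = src b
  tgt_mul : ∀ a b h, tgt (mul a b h) = tgt a
  assoc : ∀ a b c (hab : src a = tgt b) (hbc : src b = tgt c),
    mul (mul a b hab) c ((src_mul a b hab).trans hbc) =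
      mul a (mul b c hbc) (hab.trans (tgt_mul b c hbc).symm)
  one : X → A
  src_one : ∀ x, src (one x) = x
  tgt_one : ∀ x, tgt (one x) = x
  mul_one : ∀ a, mul a (one (src a)) (tgt_one _).symm = a
  one_mul : ∀ b, mul (one (tgt b)) b (src_one _) = b
  inv : A → A
  src_inv : ∀ a, src (inv a) = tgt a
  tgt_inv : ∀ a, tgt (inv a) = src a
  mul_inv : ∀ a, mul a (inv a) (tgt_inv a).symm = one (tgt a)
  inv_mul : ∀ a, mul (inv a) a (src_inv a) = one (src a)

/-- The pair of maps `(f₁, f₀)` is a functor from `G` to `H`. -/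
structure Grpd.IsFunctor {A X B Y : Type*} (G : Grpd A X) (H : Grpd B Y)
    (f₁ : A → B) (f₀ : X → Y) : Prop where
  src_map : ∀ a, H.src (f₁ a) = f₀ (G.src a)
  tgt_map : ∀ a, H.tgt (f₁ a) = f₀ (G.tgt a)
  one_map : ∀ x, H.one (f₀ x) = f₁ (G.one x)
  map_mul : ∀ a b (h : G.src a = G.tgt b),
    f₁ (G.mul a b h) = H.mul (f₁ a) (f₁ b)
      ((src_map a).trans ((congrArg f₀ h).trans (tgt_map b).symm))

/-- `G` and `H` are isomorphic as groupoids with topologized sets of morphisms, by an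
isomorphism that is the identity on the common set of objects. -/
def Grpd.IsIsoOver {A B X : Type*} [TopologicalSpace A] [TopologicalSpace B]
    (G : Grpd A X) (H : Grpd B X) : Prop :=
  ∃ φ : A ≃ₜ B, G.IsFunctor H φ id

/-- A topological groupoid over the space of objects `X`. -/
structure TopGrpd (X : Type*) [TopologicalSpace X] where
  Mor : Type w
  [top : TopologicalSpace Mor]
  grpd : Grpd Mor X
  continuous_src : Continuous grpd.src
  continuous_tgt : Continuous grpd.tgt
  continuous_one : Continuous grpd.one
  continuous_inv : Continuous grpd.inv
  continuous_mul : Continuous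
    fun p : {p : Mor × Mor // grpd.src p.1 = grpd.tgt p.2} => grpd.mul p.1.1 p.1.2 p.2

attribute [instance] TopGrpd.top

/-- The pair groupoid of `X`: a pair `(y, x)` is a morphism from `x` to `y`. -/
def pairGrpd (X : Type*) : Grpd (X × X) X where
  src a := a.2
  tgt a := a.1
  mul a b _ := (a.1, b.2)
  src_mul _ _ _ := rfl
  tgt_mul _ _ _ := rfl
  assoc _ _ _ _ _ := rfl
  one x := (x, x)
  src_one _ := rfl
  tgt_one _ := rfl
  mul_one _ := rfl
  one_mul _ := rfl
  inv a := (a.2, a.1)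
  src_inv _ := rfl
  tgt_inv _ := rfl
  mul_inv _ := rfl
  inv_mul _ := rfl

/-- The slice at `t` of a groupoid with objects `X × S`: the morphisms between objects of
`X × {t}`, regarded as a groupoid with set of objects `X`. -/
def Grpd.slice {A X S : Type*} (G : Grpd A (X × S)) (t : S) :
    Grpd {a : A // (G.src a).2 = t ∧ (G.tgt a).2 = t} X where
  src a := (G.src a.1).1
  tgt a := (G.tgt a.1).1
  mul a b h := ⟨G.mul a.1 b.1 (Prod.ext h (a.2.1.trans b.2.2.symm)),
    by rw [G.src_mul]; exact b.2.1, by rw [G.tgt_mul]; exact a.2.2⟩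
  src_mul a b h := by simp only [G.src_mul]
  tgt_mul a b h := by simp only [G.tgt_mul]
  assoc a b c hab hbc := Subtype.ext (G.assoc _ _ _ _ _)
  one x := ⟨G.one (x, t), by rw [G.src_one], by rw [G.tgt_one]⟩
  src_one x := by simp only [G.src_one]
  tgt_one x := by simp only [G.tgt_one]
  mul_one a := by
    apply Subtype.ext
    have h : ((G.src a.1).1, t) = G.src a.1 := Prod.ext rfl a.2.1.symm
    simp only [h, G.mul_one]
  one_mul a := by
    apply Subtype.ext
    have h : ((G.tgt a.1).1, t) = G.tgt a.1 := Prod.ext rfl a.2.2.symm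
    simp only [h, G.one_mul]
  inv a := ⟨G.inv a.1, by rw [G.src_inv]; exact a.2.2, by rw [G.tgt_inv]; exact a.2.1⟩
  src_inv a := by simp only [G.src_inv]
  tgt_inv a := by simp only [G.tgt_inv]
  mul_inv a := by
    apply Subtype.ext
    have h : ((G.tgt a.1).1, t) = G.tgt a.1 := Prod.ext rfl a.2.2.symm
    simp only [h, G.mul_inv]
  inv_mul a := by
    apply Subtype.ext
    have h : ((G.src a.1).1, t) = G.src a.1 := Prod.ext rfl a.2.1.symm
    simp only [h, G.inv_mul]

/-! ### Differential calculus over a good topological ring -/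

/-- A good topological ring: a Hausdorff topological ring whose unit group is dense. -/
class IsGoodRing (K : Type*) [Ring K] [TopologicalSpace K] : Prop
    extends IsTopologicalRing K, T2Space K where
  dense_units : DenseRange (Units.val : Kˣ → K)

/-- The topological ring `K` is a topological field (or skew field). -/
def IsTopField (K : Type*) [Ring K] [TopologicalSpace K] : Prop :=
  Nontrivial K ∧ (∀ a : K, a ≠ 0 → IsUnit a) ∧ ContinuousOn Ring.inverse {a : K | a ≠ 0}

section Calculus

variable (K : Type*) [Ring K] {V : Type*} [AddCommGroup V] [Module K V]
variable {W : Type*} [AddCommGroup W] [Module K W]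

/-- The first extended domain of `U`: all `(x, v, t)` with `x ∈ U` and `x + t v ∈ U`. -/
def extDomain (U : Set V) : Set (V × V × K) :=
  {p | p.1 ∈ U ∧ p.1 + p.2.2 • p.2.1 ∈ U}

/-- The tangent groupoid of a subset `U` of a module. -/
def tangentGrpd (U : Set V) : Grpd (extDomain K U) (U × K) where
  src a := (⟨a.1.1, a.2.1⟩, a.1.2.2)
  tgt a := (⟨a.1.1 + a.1.2.2 • a.1.2.1, a.2.2⟩, a.1.2.2)
  mul a b h := ⟨(b.1.1, a.1.2.1 + b.1.2.1, b.1.2.2), b.2.1, by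
    have h1 : a.1.1 = b.1.1 + b.1.2.2 • b.1.2.1 := congrArg (fun p => (p.1 : V)) h
    have h2 : a.1.2.2 = b.1.2.2 := congrArg (fun p => p.2) h
    have h3 := a.2.2
    rw [h1, h2] at h3
    have : b.1.1 + b.1.2.2 • (a.1.2.1 + b.1.2.1)
        = b.1.1 + b.1.2.2 • b.1.2.1 + b.1.2.2 • a.1.2.1 := by
      rw [smul_add]; abel
    show b.1.1 + b.1.2.2 • (a.1.2.1 + b.1.2.1) ∈ U
    rw [this]; exact h3⟩
  src_mul a b h := rfl
  tgt_mul a b h := by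
    have h1 : a.1.1 = b.1.1 + b.1.2.2 • b.1.2.1 := congrArg (fun p => (p.1 : V)) h
    have h2 : a.1.2.2 = b.1.2.2 := congrArg (fun p => p.2) h
    refine Prod.ext (Subtype.ext ?_) h2.symm
    show b.1.1 + b.1.2.2 • (a.1.2.1 + b.1.2.1) = a.1.1 + a.1.2.2 • a.1.2.1
    rw [h1, h2, smul_add]; abel
  assoc a b c hab hbc := by
    apply Subtype.ext
    refine Prod.ext rfl (Prod.ext ?_ rfl)
    exact add_assoc _ _ _
  one x := ⟨(x.1.1, 0, x.2), x.1.2, by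
    show x.1.1 + x.2 • (0 : V) ∈ U
    rw [smul_zero, add_zero]; exact x.1.2⟩
  src_one x := rfl
  tgt_one x := Prod.ext (Subtype.ext (by simp)) rfl
  mul_one a := Subtype.ext (Prod.ext rfl (Prod.ext (add_zero _) rfl))
  one_mul a := Subtype.ext (Prod.ext rfl (Prod.ext (zero_add _) rfl))
  inv a := ⟨(a.1.1 + a.1.2.2 • a.1.2.1, -a.1.2.1, a.1.2.2), a.2.2, by
    show a.1.1 + a.1.2.2 • a.1.2.1 + a.1.2.2 • (-a.1.2.1) ∈ U
    rw [smul_neg, add_neg_cancel_right]; exact a.2.1⟩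
  src_inv a := rfl
  tgt_inv a := Prod.ext (Subtype.ext (by simp)) rfl
  mul_inv a := Subtype.ext (Prod.ext rfl (Prod.ext (add_neg_cancel _) rfl))
  inv_mul a := Subtype.ext (Prod.ext rfl (Prod.ext (neg_add_cancel _) rfl))

variable [TopologicalSpace K] [TopologicalSpace V] [TopologicalSpace W]

/-- `f` is of class `C¹` on the (open) set `U`: the difference quotient, which is given for
invertible `t`, extends to a continuous map on the first extended domain of `U`. -/
def C1On (f : V → W) (U : Set V) : Prop :=
  ∃ g : V × V × K → W, ContinuousOn g (extDomain K U) ∧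
    ∀ (x v : V) (t : Kˣ), (x, v, (t : K)) ∈ extDomain K U →
      g (x, v, (t : K)) = t⁻¹ • (f (x + t • v) - f x)

/-- `w` is the derivative of `f` at `x` in direction `v`: the limit of the difference
quotient as `t` tends to `0` through invertible scalars. -/
def HasDirDeriv (f : V → W) (x v : V) (w : W) : Prop :=
  Tendsto (fun t : Kˣ => t⁻¹ • (f (x + t • v) - f x)) (comap Units.val (𝓝 (0 : K))) (𝓝 w)

end Calculus

section CalculusFacts

variable {K : Type*} [Ring K] [TopologicalSpace K] [IsGoodRing K]
variable {V : Type*} [AddCommGroup V] [Module K V] [TopologicalSpace V]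
  [IsTopologicalAddGroup V] [ContinuousSMul K V]
variable {W : Type*} [AddCommGroup W] [Module K W] [TopologicalSpace W]
  [IsTopologicalAddGroup W] [T2Space W]

instance neBot_units : (comap (Units.val : Kˣ → K) (𝓝 0)).NeBot := by
  rw [comap_neBot_iff]
  intro s hs
  obtain ⟨y, hy, t, rfl⟩ := mem_closure_iff_nhds.1 (IsGoodRing.dense_units (K := K) 0) s hs
  exact ⟨t, hy⟩

theorem HasDirDeriv.unique {f : V → W} {x v : V} {w w' : W}
    (h : HasDirDeriv K f x v w) (h' : HasDirDeriv K f x v w') : w = w' :=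
  tendsto_nhds_unique h h'

theorem HasDirDeriv.zero (f : V → W) (x : V) : HasDirDeriv K f x 0 0 := by
  simp [HasDirDeriv]

theorem tendsto_quotient {f : V → W} {U : Set V} (hU : IsOpen U)
    {g : V × V × K → W} (hg : ContinuousOn g (extDomain K U))
    (hgf : ∀ (x v : V) (t : Kˣ), (x, v, (t : K)) ∈ extDomain K U →
      g (x, v, (t : K)) = t⁻¹ • (f (x + t • v) - f x))
    {x : V} (hx : x ∈ U) (v v' : V) :
    Tendsto (fun t : Kˣ => t⁻¹ • (f (x + t • v + t • v') - f (x + t • v)))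
      (comap Units.val (𝓝 (0 : K))) (𝓝 (g (x, v', 0))) := by
  have hopen : IsOpen (extDomain K U) := by
    refine (hU.preimage continuous_fst).inter (hU.preimage ?_)
    fun_prop
  have hmem : (x, v', (0 : K)) ∈ extDomain K U := by
    refine ⟨hx, ?_⟩
    simpa using hx
  have hpath : Continuous fun t : K => (x + t • v, v', t) := by fun_prop
  have h0 : Tendsto (fun t : K => (x + t • v, v', t)) (𝓝 0) (𝓝 (x, v', 0)) := by
    have := hpath.tendsto 0
    simpa using this
  have h1 : Tendsto (fun t : Kˣ => (x + (t : K) • v, v', (t : K)))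
      (comap Units.val (𝓝 (0 : K))) (𝓝 (x, v', 0)) := h0.comp tendsto_comap
  have h2 := (hg.continuousAt (hopen.mem_nhds hmem)).tendsto.comp h1
  refine h2.congr' ?_
  filter_upwards [h1 (hopen.mem_nhds hmem)] with t ht
  exact hgf _ _ t ht

theorem HasDirDeriv.add {f : V → W} {U : Set V} (hU : IsOpen U) (hf : C1On K f U)
    {x : V} (hx : x ∈ U) {v v' : V} {w w' : W}
    (h : HasDirDeriv K f x v w) (h' : HasDirDeriv K f x v' w') :
    HasDirDeriv K f x (v + v') (w + w') := by
  obtain ⟨g, hg, hgf⟩ := hf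
  have h1 : HasDirDeriv K f x v' (g (x, v', 0)) := by
    have := tendsto_quotient hU hg hgf hx 0 v'
    simpa [HasDirDeriv] using this
  rw [h'.unique h1]
  refine (Filter.Tendsto.add h (tendsto_quotient hU hg hgf hx v v')).congr fun t => ?_
  rw [← smul_add, smul_add t v v', ← add_assoc]
  congr 1
  abel

theorem HasDirDeriv.neg {f : V → W} {U : Set V} (hU : IsOpen U) (hf : C1On K f U)
    {x : V} (hx : x ∈ U) {v : V} {w : W} (h : HasDirDeriv K f x v w) :
    HasDirDeriv K f x (-v) (-w) := by
  have hf' := hf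
  obtain ⟨g, hg, hgf⟩ := hf
  have h1 : HasDirDeriv K f x (-v) (g (x, -v, 0)) := by
    have := tendsto_quotient hU hg hgf hx 0 (-v)
    simpa [HasDirDeriv] using this
  have h2 := HasDirDeriv.add hU hf' hx h h1
  rw [add_neg_cancel] at h2
  have h3 := h2.unique (HasDirDeriv.zero f x)
  rwa [neg_eq_of_add_eq_zero_right h3]

end CalculusFacts

/-! ### Manifolds -/

/-- A Hausdorff manifold (of class `C¹`) over `K`, modelled on a Hausdorff topological
`K`-module `V`.  Over a topological field no condition is imposed on the atlas beyond the
transition maps being `C¹`.  Over other rings being `C¹` is not a local property (two charts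
with disjoint domains need not combine to a chart), and the atlas is required to have
sufficiently large chart domains: any finitely many points lie in one of them. -/
structure HausdorffManifold (K : Type*) [Ring K] [TopologicalSpace K] where
  carrier : Type u
  [topCarrier : TopologicalSpace carrier]
  [t2Carrier : T2Space carrier]
  V : Type u
  [addCommGroup : AddCommGroup V]
  [module : Module K V]
  [top : TopologicalSpace V]
  [topAddGroup : IsTopologicalAddGroup V]
  [continuousSMul : ContinuousSMul K V]
  [t2 : T2Space V]
  [chartedSpace : ChartedSpace V carrier]
  transition : ∀ e ∈ atlas V carrier, ∀ e' ∈ atlas V carrier,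
    C1On K (e' ∘ e.symm) (e.symm.trans e').source
  finite_subset_chart : IsTopField K ∨
    ∀ s : Finset carrier, s.Nonempty → ∃ e ∈ atlas V carrier, (s : Set carrier) ⊆ e.source

namespace HausdorffManifold

instance (K : Type*) [Ring K] [TopologicalSpace K] :
    CoeSort (HausdorffManifold.{u} K) (Type u) := ⟨HausdorffManifold.carrier⟩

attribute [instance] topCarrier t2Carrier addCommGroup module top topAddGroup continuousSMul
  t2 chartedSpace

variable {K : Type*} [Ring K] [TopologicalSpace K]

/-- The atlas of `M`, as a type. -/
abbrev Charts (M : HausdorffManifold.{u} K) : Type u := atlas M.V M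

/-- `f : M → N` is of class `C¹`: it is continuous and `C¹` in all pairs of charts. -/
def IsC1 {M N : HausdorffManifold.{u} K} (f : M → N) : Prop :=
  Continuous f ∧ ∀ (e : M.Charts) (e' : N.Charts),
    C1On K (e'.1 ∘ f ∘ e.1.symm) (e.1.target ∩ e.1.symm ⁻¹' (f ⁻¹' e'.1.source))

/-- An open subset of a topological `K`-module, as a manifold with the inclusion as its
only chart. -/
noncomputable def ofOpen {V : Type u} [AddCommGroup V] [Module K V] [TopologicalSpace V]
    [IsTopologicalAddGroup V] [ContinuousSMul K V] [T2Space V] (U : Set V) (hU : IsOpen U) :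
    HausdorffManifold.{u} K where
  carrier := U
  V := V
  chartedSpace :=
    { atlas := {e | ∃ _ : Nonempty U,
        e = hU.isOpenEmbedding_subtypeVal.toOpenPartialHomeomorph Subtype.val}
      chartAt := fun x =>
        haveI : Nonempty U := ⟨x⟩
        hU.isOpenEmbedding_subtypeVal.toOpenPartialHomeomorph Subtype.val
      mem_chart_source := fun x => by simp
      chart_mem_atlas := fun x => ⟨⟨x⟩, rfl⟩ }
  transition := by
    rintro e ⟨hne, rfl⟩ e' ⟨_, rfl⟩
    have key : ∀ y ∈ ((hU.isOpenEmbedding_subtypeVal.toOpenPartialHomeomorph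
          (Subtype.val : U → V)).symm.trans
        (hU.isOpenEmbedding_subtypeVal.toOpenPartialHomeomorph Subtype.val)).source,
        ((hU.isOpenEmbedding_subtypeVal.toOpenPartialHomeomorph (Subtype.val : U → V)) ∘
          (hU.isOpenEmbedding_subtypeVal.toOpenPartialHomeomorph Subtype.val).symm) y = y := by
      intro y hy
      rw [OpenPartialHomeomorph.trans_source] at hy
      exact OpenPartialHomeomorph.right_inv _ hy.1
    refine ⟨fun p => p.2.1, by fun_prop, fun x v t h => ?_⟩
    have h2 := key _ h.2
    have h1 := key _ h.1
    simp only [Units.smul_def] at h2 ⊢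
    rw [h2, h1, add_sub_cancel_left]
    exact (inv_smul_smul t v).symm
  finite_subset_chart := Or.inr fun s hs => by
    obtain ⟨x, -⟩ := hs
    exact ⟨_, ⟨⟨x⟩, rfl⟩, fun y _ => by simp⟩

/-- A tangent vector of `M`: a base point together with its components in all charts around
the base point, which transform by the derivatives of the transition maps.  (The component in
a chart whose domain does not contain the base point is set to `0`.) -/
def TangentVec (M : HausdorffManifold.{u} K) : Type u :=
  {p : M × (M.Charts → M.V) // (∀ e : M.Charts, p.1 ∉ e.1.source → p.2 e = 0) ∧
    ∀ e e' : M.Charts, p.1 ∈ e.1.source → p.1 ∈ e'.1.source →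
      HasDirDeriv K (e'.1 ∘ e.1.symm) (e.1 p.1) (p.2 e) (p.2 e')}

/-- The topology of the tangent bundle: over the domain of a chart `e` it is the topology of
`V × V`, a tangent vector being given by its base point and component in the chart `e`. -/
instance (M : HausdorffManifold.{u} K) : TopologicalSpace M.TangentVec :=
  TopologicalSpace.generateFrom
    {S | ∃ (e : M.Charts) (O : Set (M.V × M.V)), IsOpen O ∧
      S = {p : M.TangentVec | p.1.1 ∈ e.1.source ∧ (e.1 p.1.1, p.1.2 e) ∈ O}}

variable [IsGoodRing K]

theorem mem_transition_source {M : HausdorffManifold.{u} K} {e e' : M.Charts} {x : M}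
    (he : x ∈ e.1.source) (he' : x ∈ e'.1.source) :
    e.1 x ∈ (e.1.symm.trans e'.1).source := by
  rw [OpenPartialHomeomorph.trans_source]
  refine ⟨e.1.map_source he, ?_⟩
  rw [mem_preimage, e.1.left_inv he]
  exact he'

/-- The tangent bundle `TM`, a bundle of abelian groups over `M`, regarded as a groupoid. -/
def tangentBundle (M : HausdorffManifold.{u} K) : Grpd M.TangentVec M where
  src a := a.1.1
  tgt a := a.1.1
  mul a b h := ⟨(b.1.1, a.1.2 + b.1.2),
    fun e he => by
      have ha := a.2.1 e (by rw [h]; exact he)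
      have hb := b.2.1 e he
      simp [ha, hb],
    fun e e' he he' => by
      have ha := a.2.2 e e' (by rw [h]; exact he) (by rw [h]; exact he')
      rw [h] at ha
      exact HasDirDeriv.add (e.1.symm.trans e'.1).open_source
        (M.transition e.1 e.2 e'.1 e'.2) (mem_transition_source he he') ha
        (b.2.2 e e' he he')⟩
  src_mul _ _ _ := rfl
  tgt_mul _ _ h := h.symm
  assoc _ _ _ _ _ := Subtype.ext (Prod.ext rfl (add_assoc _ _ _))
  one x := ⟨(x, 0), fun _ _ => rfl, fun _ _ _ _ => HasDirDeriv.zero _ _⟩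
  src_one _ := rfl
  tgt_one _ := rfl
  mul_one a := Subtype.ext (Prod.ext rfl (add_zero _))
  one_mul a := Subtype.ext (Prod.ext rfl (zero_add _))
  inv a := ⟨(a.1.1, -a.1.2), fun e he => by simp [a.2.1 e he],
    fun e e' he he' => HasDirDeriv.neg (e.1.symm.trans e'.1).open_source
      (M.transition e.1 e.2 e'.1 e'.2) (mem_transition_source he he') (a.2.2 e e' he he')⟩
  src_inv _ := rfl
  tgt_inv _ := rfl
  mul_inv _ := Subtype.ext (Prod.ext rfl (add_neg_cancel _))
  inv_mul _ := Subtype.ext (Prod.ext rfl (neg_add_cancel _))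

/-- `F` is a continuous functor between topological groupoids over `M × K` and `N × K` that
extends the map `f : M → N`, in the sense that its map on objects is `f × id`. -/
def IsContFunctorOver {M N : HausdorffManifold.{u} K} (G : TopGrpd (M × K))
    (H : TopGrpd (N × K)) (f : M → N) (F : G.Mor → H.Mor) : Prop :=
  Continuous F ∧ G.grpd.IsFunctor H.grpd F (Prod.map f id)

end HausdorffManifold

end LieCalc

/-! A morphism of the groupoid is a `Secant`: two points of M, a scalar t, and a family of
components v, one for each chart around both points, with e(src) + t v = e(tgt) and compatible under
the extended difference quotients of the transition maps. The chain rule `slope_comp` makes such a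
family determined by any one of its members.

Two principles carry everything. First, density of units: for invertible t the extension of the
difference quotient is the difference quotient itself, so additivity (`slope_add`), the chain rule
and homogeneity (`slope_smul_scale`) are elementary algebra there; fixing the point and the
direction and letting the scalar vary, both sides are continuous, and `eq_of_eventuallyEq_units`
carries the identity to every scalar. On the manifold the same principle reads: a secant with
invertible scalar is determined by its endpoints and its scalar (`ext_of_isUnit`), such secants are
dense (`dense_isUnit`), and the space of secants is Hausdorff; hence a continuous map of secants is
determined by its effect on source, target and scalar.

Second, a dichotomy (`exists_chart_or_ne_zero`): the finitely many points involved in a construction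
lie in a common chart, or the scalars form a topological field and t is not 0. In the first case one
computes with components in that chart. In the second t is invertible, the components are forced,
and inversion is continuous near t, so only the endpoints and the scalar matter. Products,
continuity and functoriality are all settled this way.

Products add components, and a C¹ map acts on components through the slopes of its chart
expressions. Conversely, a continuous functor over f, read in charts, is itself a continuous
extension of the difference quotient of f, so f is C¹. For invertible t a secant is a pair of
points; for t = 0 the endpoints coincide and the transformation rule is that of tangent vectors. -/

namespace LieCalc
set_option linter.unusedSectionVars false

/-! ### Calculus of extended difference quotients -/

section Slope

variable {K : Type*} [Ring K] [TopologicalSpace K] [IsGoodRing K]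

/-- Functions of a scalar variable that agree at all invertible scalars near `t₀` agree at `t₀`,
if they are continuous there. -/
theorem eq_of_eventuallyEq_units {W : Type*} [TopologicalSpace W] [T2Space W] {φ ψ : K → W}
    {t₀ : K} (hφ : ContinuousAt φ t₀) (hψ : ContinuousAt ψ t₀)
    (h : ∀ᶠ t : K in 𝓝 t₀, ∀ s : Kˣ, t = (s : K) → φ t = ψ t) : φ t₀ = ψ t₀ := by
  have hne : (comap (Units.val : Kˣ → K) (𝓝 t₀)).NeBot := by
    rw [comap_neBot_iff]
    intro s hs
    obtain ⟨y, hy, t, rfl⟩ :=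
      mem_closure_iff_nhds.1 (IsGoodRing.dense_units (K := K) t₀) s hs
    exact ⟨t, hy⟩
  have ht : Tendsto (Units.val : Kˣ → K) (comap Units.val (𝓝 t₀)) (𝓝 t₀) := tendsto_comap
  refine tendsto_nhds_unique_of_eventuallyEq (hφ.tendsto.comp ht) (hψ.tendsto.comp ht) ?_
  filter_upwards [ht.eventually h] with s hs
  exact hs s rfl

variable {V : Type*} [AddCommGroup V] [Module K V] [TopologicalSpace V]
variable {W : Type*} [AddCommGroup W] [Module K W] [TopologicalSpace W]
variable {X : Type*} [AddCommGroup X] [Module K X] [TopologicalSpace X]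

variable (K) in
/-- The continuous extension of the difference quotient of a `C¹` map. -/
noncomputable def slope (f : V → W) (U : Set V) : V × V × K → W :=
  open Classical in if h : C1On K f U then h.choose else 0

theorem slope_continuousOn {f : V → W} {U : Set V} (hf : C1On K f U) :
    ContinuousOn (slope K f U) (extDomain K U) := by
  rw [slope, dif_pos hf]; exact hf.choose_spec.1

theorem slope_units {f : V → W} {U : Set V} (hf : C1On K f U) {x v : V} {t : Kˣ}
    (h : (x, v, (t : K)) ∈ extDomain K U) :
    slope K f U (x, v, (t : K)) = t⁻¹ • (f (x + t • v) - f x) := by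
  rw [slope, dif_pos hf]; exact hf.choose_spec.2 x v t h

section
variable [IsTopologicalAddGroup V] [ContinuousSMul K V]

theorem isOpen_extDomain {U : Set V} (hU : IsOpen U) : IsOpen (extDomain K U) :=
  (hU.preimage continuous_fst).inter (hU.preimage (by fun_prop))

theorem slope_continuousAt {f : V → W} {U : Set V} (hU : IsOpen U) (hf : C1On K f U)
    {p : V × V × K} (hp : p ∈ extDomain K U) : ContinuousAt (slope K f U) p :=
  (slope_continuousOn hf).continuousAt ((isOpen_extDomain hU).mem_nhds hp)

theorem eventually_mem_extDomain {U : Set V} (hU : IsOpen U) {c : K → V × V × K} {t : K}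
    (hc : ContinuousAt c t) (h : c t ∈ extDomain K U) : ∀ᶠ s in 𝓝 t, c s ∈ extDomain K U :=
  hc ((isOpen_extDomain hU).mem_nhds h)

theorem slope_zero {f : V → W} {U : Set V} [T2Space W] (hU : IsOpen U) (hf : C1On K f U)
    {x : V} {t : K} (hx : x ∈ U) : slope K f U (x, 0, t) = 0 := by
  have hp : (x, (0 : V), t) ∈ extDomain K U := ⟨hx, by simpa using hx⟩
  have hc : ContinuousAt (fun s : K => (x, (0 : V), s)) t := by fun_prop
  refine eq_of_eventuallyEq_units (φ := fun s => slope K f U (x, 0, s)) (ψ := fun _ => 0)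
    ((slope_continuousAt hU hf hp).comp_of_eq hc rfl) continuousAt_const ?_
  filter_upwards [eventually_mem_extDomain hU hc hp] with s hs r hr
  subst hr
  rw [slope_units hf hs]
  simp

/-- The slope of the identity is the direction. -/
theorem slope_of_eq_self {f : V → V} {U : Set V} [T2Space V] (hU : IsOpen U) (hf : C1On K f U)
    (h : ∀ y ∈ U, f y = y) {x v : V} {t : K} (hp : (x, v, t) ∈ extDomain K U) :
    slope K f U (x, v, t) = v := by
  have hc : ContinuousAt (fun s : K => (x, v, s)) t := by fun_prop
  refine eq_of_eventuallyEq_units (φ := fun s => slope K f U (x, v, s)) (ψ := fun _ => v)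
    ((slope_continuousAt hU hf hp).comp_of_eq hc rfl) continuousAt_const ?_
  filter_upwards [eventually_mem_extDomain hU hc hp] with s hs r hr
  subst hr
  have h2 : f (x + r • v) = x + r • v := h _ hs.2
  rw [slope_units hf hs, h2, h _ hs.1, add_sub_cancel_left, inv_smul_smul]

/-- The step (t s⁻¹)(s v) equals t v, so both slopes compare the same two values of f, and for
invertible t the quotient is taken by (t s⁻¹)⁻¹ = s t⁻¹. The order of the factors matters, since K
need not be commutative. -/
theorem slope_smul_scale {f : V → W} {U : Set V} [T2Space W] [ContinuousConstSMul K W]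
    (hU : IsOpen U) (hf : C1On K f U) {x v : V} {t : K} (hp : (x, v, t) ∈ extDomain K U)
    (s : Kˣ) : slope K f U (x, s • v, t * (s⁻¹ : Kˣ)) = s • slope K f U (x, v, t) := by
  have key : ∀ r : K, (x, s • v, r * (s⁻¹ : Kˣ)) ∈ extDomain K U ↔
      (x, v, r) ∈ extDomain K U := fun r => by
    simp only [extDomain, mem_ofPred_eq, mul_smul, ← Units.smul_def, inv_smul_smul]
  have hc : ContinuousAt (fun r : K => (x, v, r)) t := by fun_prop
  have hc' : ContinuousAt (fun r : K => (x, s • v, r * (s⁻¹ : Kˣ))) t := by fun_prop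
  refine eq_of_eventuallyEq_units (φ := fun r => slope K f U (x, s • v, r * (s⁻¹ : Kˣ)))
    (ψ := fun r => s • slope K f U (x, v, r))
    ((slope_continuousAt hU hf ((key t).2 hp)).comp_of_eq hc' rfl) ?_ ?_
  · simp only [Units.smul_def]
    exact ((slope_continuousAt hU hf hp).comp_of_eq hc rfl).const_smul (s : K)
  · filter_upwards [eventually_mem_extDomain hU hc hp] with r hr q hq
    subst hq
    have h2 := (key q).2 hr
    rw [slope_units hf hr]
    rw [← Units.val_mul] at h2 ⊢
    rw [slope_units hf h2, mul_smul, inv_smul_smul, mul_inv_rev, inv_inv, mul_smul]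

variable [IsTopologicalAddGroup W] [T2Space W]

/-- For an invertible scalar the sum of the two difference quotients telescopes through the
intermediate point. This is why products of secants are compatible with changes of charts and with
C¹ maps. -/
theorem slope_add {f : V → W} {U : Set V} (hU : IsOpen U) (hf : C1On K f U)
    {x v v' : V} {t : K} (hp : (x, v, t) ∈ extDomain K U)
    (hp' : (x + t • v, v', t) ∈ extDomain K U) :
    slope K f U (x, v' + v, t) =
      slope K f U (x + t • v, v', t) + slope K f U (x, v, t) := by
  have hq : (x, v' + v, t) ∈ extDomain K U := by
    refine ⟨hp.1, ?_⟩
    have := hp'.2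
    simp only [] at this ⊢
    rwa [smul_add, add_comm (t • v'), ← add_assoc]
  have c1 : ContinuousAt (fun s : K => (x, v, s)) t := by fun_prop
  -- The base point of the second slope moves with the scalar, so that the two steps stay composable
  -- at every nearby invertible scalar.
  have c2 : ContinuousAt (fun s : K => (x + s • v, v', s)) t := by fun_prop
  have c3 : ContinuousAt (fun s : K => (x, v' + v, s)) t := by fun_prop
  refine eq_of_eventuallyEq_units (φ := fun s => slope K f U (x, v' + v, s))
    (ψ := fun s => slope K f U (x + s • v, v', s) + slope K f U (x, v, s))
    ((slope_continuousAt hU hf hq).comp_of_eq c3 rfl)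
    (((slope_continuousAt hU hf hp').comp_of_eq c2 rfl).add
      ((slope_continuousAt hU hf hp).comp_of_eq c1 rfl)) ?_
  filter_upwards [eventually_mem_extDomain hU c1 hp, eventually_mem_extDomain hU c2 hp',
    eventually_mem_extDomain hU c3 hq] with s h1 h2 h3 r hr
  subst hr
  rw [slope_units hf h1, slope_units hf h2, slope_units hf h3]
  simp only [Units.smul_def, smul_add]
  rw [add_comm ((r : K) • v'), ← add_assoc, ← smul_add, sub_add_sub_cancel]

theorem slope_neg {f : V → W} {U : Set V} (hU : IsOpen U) (hf : C1On K f U)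
    {x v : V} {t : K} (hp : (x, v, t) ∈ extDomain K U) :
    slope K f U (x + t • v, -v, t) = -slope K f U (x, v, t) := by
  have h := slope_add hU hf hp (v' := -v) ⟨hp.2, by simpa using hp.1⟩
  rw [neg_add_cancel, slope_zero hU hf hp.1] at h
  exact eq_neg_of_add_eq_zero_left h.symm

theorem hasDirDeriv_slope {f : V → W} {U : Set V} (hU : IsOpen U) (hf : C1On K f U)
    {x : V} (v : V) (hx : x ∈ U) : HasDirDeriv K f x v (slope K f U (x, v, 0)) := by
  have := tendsto_quotient hU (slope_continuousOn hf) (fun x v t h => slope_units hf h) hx 0 v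
  simpa [HasDirDeriv] using this

variable [ContinuousSMul K W]

theorem add_smul_slope {f : V → W} {U : Set V} (hU : IsOpen U) (hf : C1On K f U)
    {x v : V} {t : K} (hp : (x, v, t) ∈ extDomain K U) (hfc : ContinuousAt f (x + t • v)) :
    f x + t • slope K f U (x, v, t) = f (x + t • v) := by
  have hc : ContinuousAt (fun s : K => (x, v, s)) t := by fun_prop
  refine eq_of_eventuallyEq_units (φ := fun s => f x + s • slope K f U (x, v, s))
    (ψ := fun s => f (x + s • v))
    (continuousAt_const.add
      (continuousAt_id.smul ((slope_continuousAt hU hf hp).comp_of_eq hc rfl)))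
    (ContinuousAt.comp_of_eq hfc (f := fun s : K => x + s • v) (by fun_prop) rfl) ?_
  filter_upwards [eventually_mem_extDomain hU hc hp] with s hs r hr
  subst hr
  rw [slope_units hf hs, ← Units.smul_def, smul_inv_smul, add_sub_cancel, Units.smul_def]

variable [IsTopologicalAddGroup X] [T2Space X]

/-- The chain rule. -/
theorem slope_comp {f : V → W} {h : W → X} {k : V → X} {U : Set V} {U' : Set W} {U'' : Set V}
    (hU : IsOpen U) (hU' : IsOpen U') (hU'' : IsOpen U'')
    (hf : C1On K f U) (hh : C1On K h U') (hk : C1On K k U'')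
    -- The composite is only required to agree with `k` where all three domain conditions hold, so
    -- the domains of chart expressions need not be matched with one another.
    (hkhf : ∀ y ∈ U, y ∈ U'' → f y ∈ U' → k y = h (f y))
    {x v : V} {t : K} (hp : (x, v, t) ∈ extDomain K U) (hp'' : (x, v, t) ∈ extDomain K U'')
    (hp' : (f x, slope K f U (x, v, t), t) ∈ extDomain K U') :
    slope K k U'' (x, v, t) = slope K h U' (f x, slope K f U (x, v, t), t) := by
  have c1 : ContinuousAt (fun s : K => (x, v, s)) t := by fun_prop
  have c2 : ContinuousAt (fun s : K => (f x, slope K f U (x, v, s), s)) t :=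
    continuousAt_const.prodMk
      (((slope_continuousAt hU hf hp).comp_of_eq c1 rfl).prodMk continuousAt_id)
  refine eq_of_eventuallyEq_units (φ := fun s => slope K k U'' (x, v, s))
    (ψ := fun s => slope K h U' (f x, slope K f U (x, v, s), s))
    ((slope_continuousAt hU'' hk hp'').comp_of_eq c1 rfl)
    ((slope_continuousAt hU' hh hp').comp_of_eq c2 rfl) ?_
  filter_upwards [eventually_mem_extDomain hU c1 hp, eventually_mem_extDomain hU'' c1 hp'',
    eventually_mem_extDomain hU' c2 hp'] with s h1 h2 h3 r hr
  subst hr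
  have h4 : f x + r • slope K f U (x, v, (r : K)) = f (x + r • v) := by
    rw [slope_units hf h1, smul_inv_smul, add_sub_cancel]
  have h5 : f (x + r • v) ∈ U' := h4 ▸ h3.2
  rw [slope_units hh h3, slope_units hk h2, h4, hkhf x h1.1 h2.1 h3.1,
    hkhf (x + r • v) h1.2 h2.2 h5]

end

end Slope

namespace HausdorffManifold

variable {K : Type w} [Ring K] [TopologicalSpace K] [IsGoodRing K]
variable {M : HausdorffManifold.{u} K}

/-! ### Components of secants in charts -/

/-- The transformation rule for the components of secants under a change of charts. -/
noncomputable def chartSlope (e e' : M.Charts) : M.V × M.V × K → M.V :=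
  slope K (e'.1 ∘ e.1.symm) (e.1.symm.trans e'.1).source

theorem mem_extDomain_transition {e e' : M.Charts} {x y : M} {v : M.V} {t : K}
    (hx : x ∈ e.1.source) (hy : y ∈ e.1.source) (hx' : x ∈ e'.1.source)
    (hy' : y ∈ e'.1.source) (h : e.1 x + t • v = e.1 y) :
    (e.1 x, v, t) ∈ extDomain K (e.1.symm.trans e'.1).source := by
  refine ⟨mem_transition_source hx hx', ?_⟩
  simp only [h]
  exact mem_transition_source hy hy'

theorem C1On_transition (e e' : M.Charts) :
    C1On K (e'.1 ∘ e.1.symm) (e.1.symm.trans e'.1).source :=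
  M.transition e.1 e.2 e'.1 e'.2

theorem chartSlope_continuousAt {e e' : M.Charts} {x y : M} {v : M.V} {t : K}
    (hx : x ∈ e.1.source) (hy : y ∈ e.1.source) (hx' : x ∈ e'.1.source)
    (hy' : y ∈ e'.1.source) (h : e.1 x + t • v = e.1 y) :
    ContinuousAt (chartSlope (K := K) e e') (e.1 x, v, t) :=
  slope_continuousAt (e.1.symm.trans e'.1).open_source (C1On_transition e e')
    (mem_extDomain_transition hx hy hx' hy' h)

theorem add_smul_inv_smul_sub {V : Type*} [AddCommGroup V] [Module K V] (a b : V) (t : Kˣ) :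
    a + (t : K) • t⁻¹ • (b - a) = b := by
  rw [← Units.smul_def, smul_inv_smul, add_sub_cancel]

theorem chartSlope_units {e e' : M.Charts} {x y : M} {t : Kˣ}
    (hx : x ∈ e.1.source) (hy : y ∈ e.1.source) (hx' : x ∈ e'.1.source)
    (hy' : y ∈ e'.1.source) :
    chartSlope e e' (e.1 x, t⁻¹ • (e.1 y - e.1 x), (t : K)) = t⁻¹ • (e'.1 y - e'.1 x) := by
  have h := add_smul_inv_smul_sub (e.1 x) (e.1 y) t
  rw [chartSlope, slope_units (C1On_transition e e')
    (mem_extDomain_transition hx hy hx' hy' h), Units.smul_def t, h]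
  simp [hx, hy]

theorem add_smul_chartSlope {e e' : M.Charts} {x y : M} {v : M.V} {t : K}
    (hx : x ∈ e.1.source) (hy : y ∈ e.1.source) (hx' : x ∈ e'.1.source)
    (hy' : y ∈ e'.1.source) (h : e.1 x + t • v = e.1 y) :
    e'.1 x + t • chartSlope e e' (e.1 x, v, t) = e'.1 y := by
  have hm := mem_extDomain_transition hx hy hx' hy' h
  have hc : ContinuousAt (e'.1 ∘ e.1.symm) (e.1 x + t • v) :=
    (e.1.symm.trans e'.1).continuousAt hm.2
  have := add_smul_slope (e.1.symm.trans e'.1).open_source (C1On_transition e e') hm hc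
  simpa [chartSlope, h, hx, hy] using this

theorem chartSlope_self {e : M.Charts} {x y : M} {v : M.V} {t : K}
    (hx : x ∈ e.1.source) (hy : y ∈ e.1.source) (h : e.1 x + t • v = e.1 y) :
    chartSlope e e (e.1 x, v, t) = v := by
  refine slope_of_eq_self (e.1.symm.trans e.1).open_source (C1On_transition e e)
    (fun z hz => ?_) (mem_extDomain_transition hx hy hx hy h)
  rw [OpenPartialHomeomorph.trans_source] at hz
  exact e.1.right_inv hz.1

/-- This cocycle identity, an instance of the chain rule, is what allows a component in one chart to
be spread consistently over all charts around both points. -/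
theorem chartSlope_comp {e e' e'' : M.Charts} {x y : M} {v : M.V} {t : K}
    (hx : x ∈ e.1.source) (hy : y ∈ e.1.source) (hx' : x ∈ e'.1.source)
    (hy' : y ∈ e'.1.source) (hx'' : x ∈ e''.1.source) (hy'' : y ∈ e''.1.source)
    (h : e.1 x + t • v = e.1 y) :
    chartSlope e e'' (e.1 x, v, t) =
      chartSlope e' e'' (e'.1 x, chartSlope e e' (e.1 x, v, t), t) := by
  have h1 := mem_extDomain_transition hx' hy' hx'' hy'' (add_smul_chartSlope hx hy hx' hy' h)
  have h2 : (e'.1 ∘ e.1.symm) (e.1 x) = e'.1 x := by simp [hx]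
  rw [← h2] at h1 ⊢
  refine slope_comp (e.1.symm.trans e'.1).open_source (e'.1.symm.trans e''.1).open_source
    (e.1.symm.trans e''.1).open_source (C1On_transition e e') (C1On_transition e' e'')
    (C1On_transition e e'') (fun z hz _ _ => ?_)
    (mem_extDomain_transition hx hy hx' hy' h) (mem_extDomain_transition hx hy hx'' hy'' h) ?_
  · rw [OpenPartialHomeomorph.trans_source] at hz
    simp only [Function.comp_apply]
    rw [e'.1.left_inv hz.2]
  · simpa [chartSlope] using h1

/-- Over a ring that is not a topological field, any finitely many points lie in one chart. -/
theorem exists_chart_or (s : Finset M) (hs : s.Nonempty) :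
    (∃ e : M.Charts, ∀ x ∈ s, x ∈ e.1.source) ∨ IsTopField K := by
  rcases M.finite_subset_chart with h | h
  · exact Or.inr h
  · obtain ⟨e, he, h⟩ := h s hs
    exact Or.inl ⟨⟨e, he⟩, fun x hx => h hx⟩

theorem exists_chart (x : M) : ∃ e : M.Charts, x ∈ e.1.source :=
  ⟨⟨chartAt M.V x, chart_mem_atlas _ _⟩, mem_chart_source _ _⟩

/-- Finitely many points that coincide if `t = 0` lie in a common chart, unless the scalars form a
field and `t ≠ 0`. -/
theorem exists_chart_or_ne_zero {t : K} (s : Finset M) (hs : s.Nonempty)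
    (h : t = 0 → ∃ x, s = {x}) :
    (∃ e : M.Charts, ∀ x ∈ s, x ∈ e.1.source) ∨ IsTopField K ∧ t ≠ 0 := by
  rcases exists_chart_or s hs with h' | hK
  · exact Or.inl h'
  by_cases h0 : t = 0
  · obtain ⟨x, rfl⟩ := h h0
    obtain ⟨e, he⟩ := exists_chart x
    exact Or.inl ⟨e, by simpa using he⟩
  · exact Or.inr ⟨hK, h0⟩

theorem exists_chart_or_isUnit {t : K} (s : Finset M) (hs : s.Nonempty)
    (h : t = 0 → ∃ x, s = {x}) :
    (∃ e : M.Charts, ∀ x ∈ s, x ∈ e.1.source) ∨ IsUnit t :=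
  (exists_chart_or_ne_zero s hs h).imp_right fun h => h.1.2.1 t h.2

/-! ### Secants -/

/-- A secant of `M`: two points and a scalar `t`, together with the components, in all charts
around both points, of a vector `v` such that the second point is the first one plus `t v`. -/
@[ext]
structure Secant (M : HausdorffManifold.{u} K) : Type (max u w) where
  src : M
  tgt : M
  scal : K
  comp : M.Charts → M.V
  isUnit_or : IsUnit scal ∨ ∃ e : M.Charts, src ∈ e.1.source ∧ tgt ∈ e.1.source
  comp_eq_zero : ∀ e : M.Charts, ¬(src ∈ e.1.source ∧ tgt ∈ e.1.source) → comp e = 0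
  add_smul_comp : ∀ e : M.Charts, src ∈ e.1.source → tgt ∈ e.1.source →
    e.1 src + scal • comp e = e.1 tgt
  chartSlope_comp : ∀ e e' : M.Charts, src ∈ e.1.source → tgt ∈ e.1.source →
    src ∈ e'.1.source → tgt ∈ e'.1.source → chartSlope e e' (e.1 src, comp e, scal) = comp e'

namespace Secant

/-- The transformation rule computes every meaningful component from the one in `e`; the remaining
ones vanish by convention. -/
theorem ext_of_comp {a b : M.Secant} (hs : a.src = b.src) (ht : a.tgt = b.tgt)
    (hk : a.scal = b.scal) {e : M.Charts} (h1 : a.src ∈ e.1.source) (h2 : a.tgt ∈ e.1.source)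
    (h : a.comp e = b.comp e) : a = b := by
  obtain ⟨x, y, t, v, ha1, ha2, ha3, ha4⟩ := a
  obtain ⟨x', y', t', v', hb1, hb2, hb3, hb4⟩ := b
  obtain rfl : x = x' := hs
  obtain rfl : y = y' := ht
  obtain rfl : t = t' := hk
  congr
  ext e'
  by_cases he' : x ∈ e'.1.source ∧ y ∈ e'.1.source
  · have h3 := ha4 e e' h1 h2 he'.1 he'.2
    have h4 := hb4 e e' h1 h2 he'.1 he'.2
    rw [← h3, ← h4, show v e = v' e from h]
  · exact (ha2 e' he').trans (hb2 e' he').symm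

theorem comp_eq_of_units (a : M.Secant) {t : Kˣ} (ht : a.scal = t) {e : M.Charts}
    (h1 : a.src ∈ e.1.source) (h2 : a.tgt ∈ e.1.source) :
    a.comp e = t⁻¹ • (e.1 a.tgt - e.1 a.src) := by
  rw [← a.add_smul_comp e h1 h2, add_sub_cancel_left, ht, ← Units.smul_def, inv_smul_smul]

/-- With t invertible, e(src) + t v = e(tgt) can be solved for v in each chart around both points.
If there is no such chart, all components are 0 by convention. -/
theorem ext_of_isUnit {a b : M.Secant} (hs : a.src = b.src) (ht : a.tgt = b.tgt)
    (hk : a.scal = b.scal) (h : IsUnit a.scal) : a = b := by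
  obtain ⟨t, h⟩ := h
  by_cases hc : ∃ e : M.Charts, a.src ∈ e.1.source ∧ a.tgt ∈ e.1.source
  · obtain ⟨e, h1, h2⟩ := hc
    refine ext_of_comp hs ht hk h1 h2 ?_
    rw [a.comp_eq_of_units h.symm h1 h2, b.comp_eq_of_units (hk ▸ h.symm) (hs ▸ h1) (ht ▸ h2),
      hs, ht]
  · refine Secant.ext hs ht hk (funext fun e => ?_)
    rw [a.comp_eq_zero e fun h => hc ⟨e, h⟩,
      b.comp_eq_zero e fun h => hc ⟨e, by rw [hs, ht]; exact h⟩]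

/-- The secant from `x` to `y` for an invertible scalar. -/
noncomputable def ofUnit (x y : M) (t : Kˣ) : M.Secant where
  src := x
  tgt := y
  scal := t
  comp e := open Classical in
    if x ∈ e.1.source ∧ y ∈ e.1.source then t⁻¹ • (e.1 y - e.1 x) else 0
  isUnit_or := Or.inl t.isUnit
  comp_eq_zero e he := if_neg he
  add_smul_comp e h1 h2 := by
    rw [if_pos ⟨h1, h2⟩, add_smul_inv_smul_sub]
  chartSlope_comp e e' h1 h2 h3 h4 := by
    rw [if_pos ⟨h1, h2⟩, if_pos ⟨h3, h4⟩, chartSlope_units h1 h2 h3 h4]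

/-- The secant with given component in a chart around its source and target. -/
noncomputable def ofVec (e : M.Charts) (x y : M) (v : M.V) (t : K) (hx : x ∈ e.1.source)
    (hy : y ∈ e.1.source) (h : e.1 x + t • v = e.1 y) : M.Secant where
  src := x
  tgt := y
  scal := t
  comp e' := open Classical in
    if x ∈ e'.1.source ∧ y ∈ e'.1.source then chartSlope e e' (e.1 x, v, t) else 0
  isUnit_or := Or.inr ⟨e, hx, hy⟩
  comp_eq_zero e he := if_neg he
  add_smul_comp e' h1 h2 := by
    rw [if_pos ⟨h1, h2⟩, add_smul_chartSlope hx hy h1 h2 h]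
  chartSlope_comp e' e'' h1 h2 h3 h4 := by
    rw [if_pos ⟨h1, h2⟩, if_pos ⟨h3, h4⟩]
    exact (HausdorffManifold.chartSlope_comp hx hy h1 h2 h3 h4 h).symm

theorem ofVec_comp {e : M.Charts} {x y : M} {v : M.V} {t : K} (hx : x ∈ e.1.source)
    (hy : y ∈ e.1.source) (h : e.1 x + t • v = e.1 y) : (ofVec e x y v t hx hy h).comp e = v :=
  (if_pos ⟨hx, hy⟩).trans (chartSlope_self hx hy h)

/-- The secant of `M` given by a point of the first extended domain of a chart image. -/
noncomputable def ofChart (e : M.Charts) (p : extDomain K e.1.target) : M.Secant :=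
  ofVec e (e.1.symm p.1.1) (e.1.symm (p.1.1 + p.1.2.2 • p.1.2.1)) p.1.2.1 p.1.2.2
    (e.1.map_target p.2.1) (e.1.map_target p.2.2)
    (by rw [e.1.right_inv p.2.1, e.1.right_inv p.2.2])

theorem ofChart_comp (e : M.Charts) (p : extDomain K e.1.target) :
    (ofChart e p).comp e = p.1.2.1 := ofVec_comp _ _ _

theorem ofChart_mem (e : M.Charts) (p : extDomain K e.1.target) :
    (ofChart e p).src ∈ e.1.source ∧ (ofChart e p).tgt ∈ e.1.source :=
  ⟨e.1.map_target p.2.1, e.1.map_target p.2.2⟩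

/-- The coordinates of a secant in a chart. -/
def coord (e : M.Charts) (a : M.Secant) : M.V × M.V × K := (e.1 a.src, a.comp e, a.scal)

theorem coord_mem {e : M.Charts} {a : M.Secant} (h1 : a.src ∈ e.1.source)
    (h2 : a.tgt ∈ e.1.source) : coord e a ∈ extDomain K e.1.target :=
  ⟨e.1.map_source h1, by
    show e.1 a.src + a.scal • a.comp e ∈ e.1.target
    rw [a.add_smul_comp e h1 h2]; exact e.1.map_source h2⟩

theorem coord_ofChart (e : M.Charts) (p : extDomain K e.1.target) :
    coord e (ofChart e p) = p.1 :=
  Prod.ext (e.1.right_inv p.2.1) (Prod.ext (ofChart_comp e p) rfl)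

theorem ofChart_coord {e : M.Charts} {a : M.Secant} (h1 : a.src ∈ e.1.source)
    (h2 : a.tgt ∈ e.1.source) : ofChart e ⟨coord e a, coord_mem h1 h2⟩ = a := by
  refine (ext_of_comp (a := a) (b := ofChart e ⟨coord e a, coord_mem h1 h2⟩) ?_ ?_ rfl h1 h2
    (ofChart_comp e ⟨coord e a, coord_mem h1 h2⟩).symm).symm
  · exact (e.1.left_inv h1).symm
  · show a.tgt = e.1.symm (e.1 a.src + a.scal • a.comp e)
    rw [a.add_smul_comp e h1 h2, e.1.left_inv h2]

theorem ofUnit_eq {a : M.Secant} {t : Kˣ} (h : a.scal = t) : ofUnit a.src a.tgt t = a :=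
  ext_of_isUnit rfl rfl h.symm t.isUnit

/-- In a chart around both points the two images agree, and charts are injective. Such a chart comes
from the condition on the atlas, or, over a field, from 0 not being a unit; the zero ring falls
under the first case. -/
theorem src_eq_tgt {a : M.Secant} (h : a.scal = 0) : a.src = a.tgt := by
  classical
  have key : ∃ e : M.Charts, a.src ∈ e.1.source ∧ a.tgt ∈ e.1.source := by
    rcases exists_chart_or ({a.src, a.tgt} : Finset M) (by simp) with ⟨e, he⟩ | hK
    · exact ⟨e, by simpa using he⟩
    · have : Nontrivial K := hK.1
      exact a.isUnit_or.resolve_left fun h1 => not_isUnit_zero (h ▸ h1)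
  obtain ⟨e, h1, h2⟩ := key
  have h3 := a.add_smul_comp e h1 h2
  rw [h, zero_smul, add_zero] at h3
  exact e.1.injOn h1 h2 h3

/-! ### The topology on the set of secants -/

/-- The finest topology such that secants depend continuously on their components in charts and,
for invertible scalars, on source and target. -/
noncomputable instance : TopologicalSpace M.Secant :=
  (⨆ e : M.Charts, TopologicalSpace.coinduced (ofChart e) inferInstance) ⊔
    TopologicalSpace.coinduced (fun p : M × M × Kˣ => ofUnit p.1 p.2.1 p.2.2) inferInstance

theorem isOpen_iff {S : Set M.Secant} : IsOpen S ↔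
    (∀ e, IsOpen (ofChart e ⁻¹' S)) ∧
      IsOpen ((fun p : M × M × Kˣ => ofUnit p.1 p.2.1 p.2.2) ⁻¹' S) := by
  -- Openness for a join of topologies unfolds to openness for both of them, and openness for a
  -- coinduced topology to openness of the preimage.
  refine Iff.trans Iff.rfl (and_congr ?_ Iff.rfl)
  exact isOpen_iSup_iff

theorem continuous_iff {Y : Type*} [TopologicalSpace Y] {f : M.Secant → Y} : Continuous f ↔
    (∀ e, Continuous (f ∘ ofChart e)) ∧
      Continuous (f ∘ fun p : M × M × Kˣ => ofUnit p.1 p.2.1 p.2.2) := by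
  simp only [continuous_def, isOpen_iff, preimage_comp]
  exact ⟨fun h => ⟨fun e s hs => (h s hs).1 e, fun s hs => (h s hs).2⟩,
    fun h s hs => ⟨fun e => h.1 e s hs, h.2 s hs⟩⟩

theorem continuous_ofChart (e : M.Charts) : Continuous (ofChart e) :=
  (continuous_iff.1 continuous_id).1 e

theorem continuous_ofUnit : Continuous fun p : M × M × Kˣ => ofUnit p.1 p.2.1 p.2.2 :=
  (continuous_iff.1 continuous_id).2

theorem continuous_src : Continuous (src : M.Secant → M) := by
  refine continuous_iff.2 ⟨fun e => ?_, continuous_fst⟩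
  exact e.1.continuousOn_symm.comp_continuous (by fun_prop) fun p => p.2.1

theorem continuous_tgt : Continuous (tgt : M.Secant → M) := by
  refine continuous_iff.2 ⟨fun e => ?_, continuous_snd.fst⟩
  exact e.1.continuousOn_symm.comp_continuous (by fun_prop) fun p => p.2.2

theorem continuous_scal : Continuous (scal : M.Secant → K) := by
  refine continuous_iff.2 ⟨fun e => ?_, Units.continuous_val.comp continuous_snd.snd⟩
  exact continuous_subtype_val.snd.snd

/-- The set of secants with source and target in a chart domain. -/
def overChart (e : M.Charts) : Set M.Secant := {a | a.src ∈ e.1.source ∧ a.tgt ∈ e.1.source}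

theorem isOpen_overChart (e : M.Charts) : IsOpen (overChart e) :=
  (e.1.open_source.preimage continuous_src).inter (e.1.open_source.preimage continuous_tgt)

theorem overChart_mem_nhds {e : M.Charts} {a : M.Secant} (h1 : a.src ∈ e.1.source)
    (h2 : a.tgt ∈ e.1.source) : overChart e ∈ 𝓝 a := (isOpen_overChart e).mem_nhds ⟨h1, h2⟩

theorem isOpen_preimage_overChart_inter {Y : Type*} [TopologicalSpace Y] {g : Y → M.Secant}
    {e : M.Charts} (hg : Continuous g)
    (h : ∀ y, g y ∈ overChart e → ContinuousAt (fun y => (g y).comp e) y) {O : Set M.V}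
    (hO : IsOpen O) : IsOpen (g ⁻¹' (overChart e ∩ (fun a => a.comp e) ⁻¹' O)) := by
  rw [isOpen_iff_mem_nhds]
  rintro y ⟨h1, h2⟩
  exact inter_mem (hg.continuousAt ((isOpen_overChart e).mem_nhds h1))
    (h y h1 (hO.mem_nhds h2))

/-- The topology is a final one, so continuity is tested along its generators. Along `ofChart e'`
the component in `e` is given by the continuous map `chartSlope e' e`; along `ofUnit` it is a
difference quotient, continuous because inversion is continuous on the unit group with its own
topology. -/
theorem continuousAt_comp {e : M.Charts} {a : M.Secant} (h1 : a.src ∈ e.1.source)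
    (h2 : a.tgt ∈ e.1.source) : ContinuousAt (fun a : M.Secant => a.comp e) a := by
  suffices ContinuousOn (fun a : M.Secant => a.comp e) (overChart e) from
    this.continuousAt (overChart_mem_nhds h1 h2)
  rw [continuousOn_open_iff (isOpen_overChart e)]
  intro O hO
  refine isOpen_iff.2 ⟨fun e' => ?_, ?_⟩
  · refine isOpen_preimage_overChart_inter (continuous_ofChart e') (fun p hp => ?_) hO
    have hev : ∀ᶠ q in 𝓝 p, ofChart e' q ∈ overChart e :=
      (continuous_ofChart e').continuousAt ((isOpen_overChart e).mem_nhds hp)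
    have hc : ContinuousAt (fun q : extDomain K e'.1.target => chartSlope e' e q.1) p := by
      refine ContinuousAt.comp_of_eq (chartSlope_continuousAt (ofChart_mem e' p).1
        (ofChart_mem e' p).2 hp.1 hp.2
        ((ofChart e' p).add_smul_comp e' (ofChart_mem e' p).1 (ofChart_mem e' p).2))
        continuousAt_subtype_val (coord_ofChart e' p).symm
    refine hc.congr ?_
    filter_upwards [hev] with q hq
    rw [← (ofChart e' q).chartSlope_comp e' e (ofChart_mem e' q).1 (ofChart_mem e' q).2
      hq.1 hq.2]
    exact congrArg _ (coord_ofChart e' q).symm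
  · refine isOpen_preimage_overChart_inter continuous_ofUnit (fun p hp => ?_) hO
    have hev : ∀ᶠ q : M × M × Kˣ in 𝓝 p, ofUnit q.1 q.2.1 q.2.2 ∈ overChart e :=
      continuous_ofUnit.continuousAt ((isOpen_overChart e).mem_nhds hp)
    have hc1 : ContinuousAt (fun q : M × M × Kˣ => e.1 q.1) p :=
      (e.1.continuousAt hp.1).comp_of_eq continuousAt_fst rfl
    have hc2 : ContinuousAt (fun q : M × M × Kˣ => e.1 q.2.1) p :=
      (e.1.continuousAt hp.2).comp_of_eq continuousAt_snd.fst rfl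
    have hc3 : ContinuousAt (fun q : M × M × Kˣ => q.2.2⁻¹) p := by fun_prop
    refine (hc3.smul (hc2.sub hc1)).congr ?_
    filter_upwards [hev] with q hq
    exact (if_pos hq).symm

theorem continuousAt_coord {e : M.Charts} {a : M.Secant} (h1 : a.src ∈ e.1.source)
    (h2 : a.tgt ∈ e.1.source) : ContinuousAt (coord e) a :=
  ((e.1.continuousAt h1).comp continuous_src.continuousAt).prodMk
    ((continuousAt_comp h1 h2).prodMk continuous_scal.continuousAt)

/-- The coordinates in `e` form a continuous inverse on the open set of secants over the chart
domain, so gluing with the other charts and with `ofUnit` creates no new identifications or finer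
open sets there. -/
theorem isOpenEmbedding_ofChart (e : M.Charts) : IsOpenEmbedding (ofChart e) := by
  refine IsOpenEmbedding.of_continuous_injective_isOpenMap (continuous_ofChart e)
    (fun p q h => Subtype.ext ?_) ?_
  · rw [← coord_ofChart, h, coord_ofChart]
  · rintro _ ⟨O, hO, rfl⟩
    rw [isOpen_iff_mem_nhds]
    rintro _ ⟨p, hp, rfl⟩
    have h := ofChart_mem e p
    have h3 : coord e ⁻¹' O ∈ 𝓝 (ofChart e p) :=
      continuousAt_coord h.1 h.2 (by rw [coord_ofChart]; exact hO.mem_nhds hp)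
    filter_upwards [h3, overChart_mem_nhds h.1 h.2] with a ha ha'
    exact ⟨_, ha, ofChart_coord ha'.1 ha'.2⟩

theorem range_ofChart (e : M.Charts) : range (ofChart e) = overChart e := by
  ext a
  constructor
  · rintro ⟨p, rfl⟩
    exact ofChart_mem e p
  · exact fun h => ⟨_, ofChart_coord h.1 h.2⟩

/-! ### Criteria for continuity of maps into the space of secants -/

section Continuity

variable {Y : Type*} [TopologicalSpace Y] {g : Y → M.Secant} {y : Y}

/-- A final topology gives no direct handle on maps into it. Here the map is, near `y`, its
coordinate expression followed by the continuous `ofChart e`. -/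
theorem continuousAt_of_chart {e : M.Charts} (h1 : (g y).src ∈ e.1.source)
    (h2 : (g y).tgt ∈ e.1.source) (hs : ContinuousAt (fun z => (g z).src) y)
    (ht : ContinuousAt (fun z => (g z).tgt) y) (hk : ContinuousAt (fun z => (g z).scal) y)
    (hc : ContinuousAt (fun z => (g z).comp e) y) : ContinuousAt g y := by
  have hco : ContinuousAt (fun z => coord e (g z)) y :=
    ((e.1.continuousAt h1).comp_of_eq hs rfl).prodMk (hc.prodMk hk)
  rw [ContinuousAt, ← ofChart_coord h1 h2, (nhds_basis_opens _).tendsto_right_iff]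
  rintro S ⟨hmem, hS⟩
  obtain ⟨O, hO, hOS⟩ := hS.preimage (continuous_ofChart e)
  have hmem' : (⟨coord e (g y), coord_mem h1 h2⟩ : extDomain K e.1.target) ∈
    ofChart e ⁻¹' S := hmem
  rw [← hOS] at hmem'
  filter_upwards [hco (hO.mem_nhds hmem'), hs (e.1.open_source.mem_nhds h1),
    ht (e.1.open_source.mem_nhds h2)] with z hz h1z h2z
  have : (⟨coord e (g z), coord_mem h1z h2z⟩ : extDomain K e.1.target) ∈ Subtype.val ⁻¹' O := hz
  rw [hOS] at this
  rw [← ofChart_coord h1z h2z]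
  exact this

/-- The topology of the unit group also records inverses, and inversion is continuous away from 0 in
a topological field. The value 1 at the scalar 0 is a placeholder. -/
theorem exists_continuousAt_units (hK : IsTopField K) {t : K} (ht : t ≠ 0) :
    ∃ u : K → Kˣ, ContinuousAt u t ∧ ∀ s ≠ 0, (u s : K) = s := by
  classical
  refine ⟨fun s => if h : s = 0 then 1 else (hK.2.1 s h).unit, ?_, fun s hs => by simp [hs]⟩
  rw [Units.isEmbedding_embedProduct.isInducing.continuousAt_iff]
  have hev : ∀ᶠ s in 𝓝 t, s ≠ 0 := isOpen_ne.mem_nhds ht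
  refine ContinuousAt.prodMk (continuousAt_id.congr ?_)
    (MulOpposite.continuous_op.continuousAt.comp
      ((hK.2.2.continuousAt hev).congr ?_))
  · filter_upwards [hev] with s hs
    simp [hs]
  · filter_upwards [hev] with s hs
    rw [dif_neg hs]
    exact Ring.inverse_of_isUnit (hK.2.1 s hs)

/-- Near `y` the scalar stays nonzero, hence invertible, so the map is `ofUnit` applied to its
endpoints and a continuously varying unit; no chart is needed. -/
theorem continuousAt_of_ne_zero (hK : IsTopField K) (h0 : (g y).scal ≠ 0)
    (hs : ContinuousAt (fun z => (g z).src) y) (ht : ContinuousAt (fun z => (g z).tgt) y)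
    (hk : ContinuousAt (fun z => (g z).scal) y) : ContinuousAt g y := by
  obtain ⟨u, hu, hu'⟩ := exists_continuousAt_units hK h0
  have hc : ContinuousAt (fun z => ofUnit (g z).src (g z).tgt (u (g z).scal)) y :=
    continuous_ofUnit.continuousAt.comp (hs.prodMk (ht.prodMk (hu.comp_of_eq hk rfl)))
  refine hc.congr ?_
  filter_upwards [hk (isOpen_ne.mem_nhds h0)] with z hz
  exact ofUnit_eq (hu' _ hz).symm

end Continuity

/-- Distinct secants with the same endpoints and scalar have a non-invertible scalar, hence lie over
one chart, where the open embedding `ofChart` separates them. -/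
instance : T2Space M.Secant := by
  refine ⟨fun a b hab => ?_⟩
  by_cases hs : a.src = b.src
  swap
  · exact separated_by_continuous continuous_src hs
  by_cases ht : a.tgt = b.tgt
  swap
  · exact separated_by_continuous continuous_tgt ht
  by_cases hk : a.scal = b.scal
  swap
  · exact separated_by_continuous continuous_scal hk
  rcases a.isUnit_or with h | ⟨e, h1, h2⟩
  · exact absurd (ext_of_isUnit hs ht hk h) hab
  · obtain ⟨p, rfl⟩ := (range_ofChart e).ge (show a ∈ overChart e from ⟨h1, h2⟩)
    obtain ⟨q, rfl⟩ := (range_ofChart e).ge (show b ∈ overChart e from ⟨hs ▸ h1, ht ▸ h2⟩)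
    exact separated_by_isOpenEmbedding (isOpenEmbedding_ofChart e) fun h => hab (h ▸ rfl)

/-- In a chart, keep the source and the component and perturb only the scalar (the target moves
along): the extended domain is open and units are dense in K. -/
theorem dense_isUnit : Dense {a : M.Secant | IsUnit a.scal} := by
  intro a
  rcases a.isUnit_or with h | ⟨e, h1, h2⟩
  · exact subset_closure h
  rw [mem_closure_iff_nhds]
  intro S hS
  rw [← ofChart_coord h1 h2] at hS
  have h3 := (isOpenEmbedding_ofChart e).continuous.continuousAt hS
  rw [mem_map, nhds_subtype, mem_comap] at h3
  obtain ⟨O, hO, hOS⟩ := h3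
  have hc : ContinuousAt (fun t : K => (e.1 a.src, a.comp e, t)) a.scal := by fun_prop
  obtain ⟨t, ⟨ht, ht'⟩, s, rfl⟩ := mem_closure_iff_nhds.1 (IsGoodRing.dense_units (K := K) a.scal)
    _ (inter_mem (hc hO) (eventually_mem_extDomain e.1.open_target hc (coord_mem h1 h2)))
  exact ⟨ofChart e ⟨_, ht'⟩, @hOS ⟨_, ht'⟩ ht, s.isUnit⟩

theorem funext_of_isUnit {Z : Type*} [TopologicalSpace Z] [T2Space Z] {f g : M.Secant → Z}
    (hf : Continuous f) (hg : Continuous g) (h : ∀ a : M.Secant, IsUnit a.scal → f a = g a) :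
    f = g :=
  Continuous.ext_on dense_isUnit hf hg h

end Secant
end HausdorffManifold

namespace HausdorffManifold

variable {K : Type w} [Ring K] [TopologicalSpace K] [IsGoodRing K]
variable {M N : HausdorffManifold.{u} K}

namespace Secant

/-! ### The groupoid of secants -/

/-- The points relevant for a product lie in one chart, unless the scalars form a field and the
scalar at hand is not zero. -/
theorem exists_chart_or_of_composable (a b : M.Secant) (h : a.src = b.tgt)
    (hk : a.scal = b.scal) : (∃ e : M.Charts, b.src ∈ e.1.source ∧ b.tgt ∈ e.1.source ∧
      a.tgt ∈ e.1.source) ∨ IsTopField K ∧ b.scal ≠ 0 := by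
  classical
  refine (exists_chart_or_ne_zero (t := b.scal) {b.src, b.tgt, a.tgt} (by simp)
    (fun h0 => ⟨b.src, ?_⟩)).imp_left fun ⟨e, he⟩ => ⟨e, by simpa using he⟩
  rw [← src_eq_tgt (hk.trans h0), h, ← src_eq_tgt h0]
  simp

/-- Add the components in one chart around the three points; by `slope_add` the sums in all other
such charts agree with it. If no chart contains the three points, the scalar is invertible, the
endpoints determine the product, and the condition on components is vacuous. -/
theorem exists_mul (a b : M.Secant) (h : a.src = b.tgt) (hk : a.scal = b.scal) :
    ∃ m : M.Secant, m.src = b.src ∧ m.tgt = a.tgt ∧ m.scal = b.scal ∧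
      ∀ e : M.Charts, b.src ∈ e.1.source → b.tgt ∈ e.1.source → a.tgt ∈ e.1.source →
        m.comp e = a.comp e + b.comp e := by
  by_cases hc : ∃ e : M.Charts, b.src ∈ e.1.source ∧ b.tgt ∈ e.1.source ∧ a.tgt ∈ e.1.source
  · obtain ⟨e, h1, h2, h3⟩ := hc
    have hb := b.add_smul_comp e h1 h2
    have ha := a.add_smul_comp e (h ▸ h2) h3
    have heq : e.1 b.src + b.scal • (a.comp e + b.comp e) = e.1 a.tgt := by
      rw [← ha, h, ← hb, hk, smul_add, add_assoc, add_comm (b.scal • a.comp e)]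
    refine ⟨ofVec e b.src a.tgt _ b.scal h1 h3 heq, rfl, rfl, rfl, fun e' h1' h2' h3' => ?_⟩
    have hb' := b.chartSlope_comp e e' h1 h2 h1' h2'
    have ha' := a.chartSlope_comp e e' (h ▸ h2) h3 (h ▸ h2') h3'
    have hm := mem_extDomain_transition (h ▸ h2) h3 (h ▸ h2') h3' ha
    rw [← (ofVec e b.src a.tgt _ b.scal h1 h3 heq).chartSlope_comp e e' h1 h3 h1' h3',
      ofVec_comp, ← hb', ← ha']
    rw [h, hk, ← hb] at hm ⊢
    exact slope_add (e.1.symm.trans e'.1).open_source (C1On_transition e e')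
      (mem_extDomain_transition h1 h2 h1' h2' hb) hm
  · obtain ⟨hK, h0⟩ := (exists_chart_or_of_composable a b h hk).resolve_left hc
    obtain ⟨t, ht⟩ := hK.2.1 _ h0
    exact ⟨ofUnit b.src a.tgt t, rfl, rfl, ht, fun e h1 h2 h3 => absurd ⟨e, h1, h2, h3⟩ hc⟩

/-- The product of composable secants, whose components are the sums of components. -/
noncomputable def mul (a b : M.Secant) (h : a.src = b.tgt) (hk : a.scal = b.scal) : M.Secant :=
  (exists_mul a b h hk).choose

section
variable (a b : M.Secant) (h : a.src = b.tgt) (hk : a.scal = b.scal)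

theorem mul_src : (mul a b h hk).src = b.src := (exists_mul a b h hk).choose_spec.1

theorem mul_tgt : (mul a b h hk).tgt = a.tgt := (exists_mul a b h hk).choose_spec.2.1

theorem mul_scal : (mul a b h hk).scal = b.scal := (exists_mul a b h hk).choose_spec.2.2.1

theorem mul_comp {e : M.Charts} (h1 : b.src ∈ e.1.source) (h2 : b.tgt ∈ e.1.source)
    (h3 : a.tgt ∈ e.1.source) : (mul a b h hk).comp e = a.comp e + b.comp e :=
  (exists_mul a b h hk).choose_spec.2.2.2 e h1 h2 h3

/-- The test used for all identities about products: besides endpoints and scalar, a single chart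
suffices, and none is needed for an invertible scalar. -/
theorem mul_eq {m : M.Secant} (hms : m.src = b.src) (hmt : m.tgt = a.tgt)
    (hmk : m.scal = b.scal) (hm : IsUnit m.scal ∨ ∃ e : M.Charts, b.src ∈ e.1.source ∧
      b.tgt ∈ e.1.source ∧ a.tgt ∈ e.1.source ∧ m.comp e = a.comp e + b.comp e) :
    mul a b h hk = m := by
  rcases hm with hu | ⟨e, h1, h2, h3, hm⟩
  · exact (ext_of_isUnit (hms.trans (mul_src ..).symm) (hmt.trans (mul_tgt ..).symm)
      (hmk.trans (mul_scal ..).symm) hu).symm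
  · exact (ext_of_comp (hms.trans (mul_src ..).symm) (hmt.trans (mul_tgt ..).symm)
      (hmk.trans (mul_scal ..).symm) (hms ▸ h1) (hmt ▸ h3)
      (hm.trans (mul_comp a b h hk h1 h2 h3).symm)).symm
end

/-- The secant with all components zero. -/
def zero (x : M) (t : K) : M.Secant where
  src := x
  tgt := x
  scal := t
  comp _ := 0
  isUnit_or := Or.inr ((exists_chart x).imp fun _ h => ⟨h, h⟩)
  comp_eq_zero _ _ := rfl
  add_smul_comp _ _ _ := by rw [smul_zero, add_zero]
  chartSlope_comp e e' h1 _ h3 _ := slope_zero (e.1.symm.trans e'.1).open_source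
    (C1On_transition e e') (mem_transition_source h1 h3)

/-- The opposite secant. -/
def neg (a : M.Secant) : M.Secant where
  src := a.tgt
  tgt := a.src
  scal := a.scal
  comp e := -a.comp e
  isUnit_or := a.isUnit_or.imp_right fun ⟨e, h⟩ => ⟨e, h.2, h.1⟩
  comp_eq_zero e he := by rw [a.comp_eq_zero e fun h => he ⟨h.2, h.1⟩, neg_zero]
  add_smul_comp e h1 h2 := by
    rw [← a.add_smul_comp e h2 h1, smul_neg, add_neg_cancel_right]
  chartSlope_comp e e' h1 h2 h3 h4 := by
    rw [← a.chartSlope_comp e e' h2 h1 h4 h3, ← a.add_smul_comp e h2 h1]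
    exact slope_neg (e.1.symm.trans e'.1).open_source (C1On_transition e e')
      (mem_extDomain_transition h2 h1 h4 h3 (a.add_smul_comp e h2 h1))

variable (M) in
/-- The groupoid of secants. -/
noncomputable def grpd : Grpd M.Secant (M × K) where
  src a := (a.src, a.scal)
  tgt a := (a.tgt, a.scal)
  mul a b h := mul a b (congrArg Prod.fst h) (congrArg Prod.snd h)
  src_mul a b h := Prod.ext (mul_src ..) (mul_scal ..)
  tgt_mul a b h := Prod.ext (mul_tgt ..) ((mul_scal ..).trans (congrArg Prod.snd h).symm)
  assoc a b c hab hbc := by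
    classical
    have h1 : a.src = b.tgt := congrArg Prod.fst hab
    have h2 : a.scal = b.scal := congrArg Prod.snd hab
    have h3 : b.src = c.tgt := congrArg Prod.fst hbc
    have h4 : b.scal = c.scal := congrArg Prod.snd hbc
    -- Associativity involves four points, which collapse to one if the scalar is 0. In a common
    -- chart it is associativity of addition; otherwise the scalar is invertible and endpoints
    -- decide.
    rcases exists_chart_or_isUnit (t := c.scal) ({a.tgt, b.tgt, c.tgt, c.src} : Finset M) (by simp)
      (fun h0 => ⟨c.src, by
        rw [← src_eq_tgt (h2.trans (h4.trans h0)), h1, ← src_eq_tgt (h4.trans h0), h3,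
          ← src_eq_tgt h0]
        simp⟩) with ⟨e, he⟩ | hu
    · have ha := he a.tgt (by simp)
      have hb := he b.tgt (by simp)
      have hc := he c.tgt (by simp)
      have hc' := he c.src (by simp)
      refine ext_of_comp (e := e) ?_ ?_ ?_ ?_ ?_ ?_
      · simp only [mul_src]
      · simp only [mul_tgt]
      · simp only [mul_scal]
      · simpa only [mul_src] using hc'
      · simpa only [mul_tgt] using ha
      · rw [mul_comp _ _ _ _ hc' hc (by simpa only [mul_tgt] using ha),
          mul_comp _ _ _ _ (h3 ▸ hc) hb ha,
          mul_comp _ _ _ _ (by simpa only [mul_src] using hc') (by simpa only [mul_tgt] using hb)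
            ha, mul_comp _ _ _ _ hc' hc hb, add_assoc]
    · refine ext_of_isUnit ?_ ?_ ?_ ?_
      · simp only [mul_src]
      · simp only [mul_tgt]
      · simp only [mul_scal]
      · simpa only [mul_scal] using hu
  one x := zero x.1 x.2
  src_one _ := rfl
  tgt_one _ := rfl
  mul_one a := mul_eq a (zero a.src a.scal) rfl rfl rfl rfl rfl
    (a.isUnit_or.imp_right fun ⟨e, h1, h2⟩ => ⟨e, h1, h1, h2, (add_zero _).symm⟩)
  one_mul a := mul_eq (zero a.tgt a.scal) a rfl rfl rfl rfl rfl
    (a.isUnit_or.imp_right fun ⟨e, h1, h2⟩ => ⟨e, h1, h2, h2, (zero_add _).symm⟩)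
  inv := neg
  src_inv _ := rfl
  tgt_inv _ := rfl
  mul_inv a := mul_eq a (neg a) rfl rfl rfl rfl rfl
    (a.isUnit_or.imp_right fun ⟨e, h1, h2⟩ => ⟨e, h2, h1, h2, (add_neg_cancel _).symm⟩)
  inv_mul a := mul_eq (neg a) a rfl rfl rfl rfl rfl
    (a.isUnit_or.imp_right fun ⟨e, h1, h2⟩ => ⟨e, h1, h2, h1, (neg_add_cancel _).symm⟩)

theorem continuous_zero : Continuous fun x : M × K => zero x.1 x.2 := by
  rw [continuous_iff_continuousAt]
  intro x
  obtain ⟨e, he⟩ := exists_chart x.1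
  exact continuousAt_of_chart (e := e) he he continuousAt_fst continuousAt_fst continuousAt_snd
    continuousAt_const

theorem continuous_neg : Continuous (neg : M.Secant → M.Secant) := by
  classical
  rw [continuous_iff_continuousAt]
  intro a
  have hs : ContinuousAt (fun z : M.Secant => (neg z).src) a := continuous_tgt.continuousAt
  have ht : ContinuousAt (fun z : M.Secant => (neg z).tgt) a := continuous_src.continuousAt
  have hk : ContinuousAt (fun z : M.Secant => (neg z).scal) a := continuous_scal.continuousAt
  rcases exists_chart_or_ne_zero (t := a.scal) {a.src, a.tgt} (by simp)
    (fun h => ⟨a.src, by simp [src_eq_tgt h]⟩) with ⟨e, he⟩ | ⟨hK, h0⟩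
  · have h1 := he a.src (by simp)
    have h2 := he a.tgt (by simp)
    exact continuousAt_of_chart (e := e) h2 h1 hs ht hk (continuousAt_comp h1 h2).neg
  · exact continuousAt_of_ne_zero hK h0 hs ht hk

theorem continuous_mul : Continuous fun p : {p : M.Secant × M.Secant //
    (grpd M).src p.1 = (grpd M).tgt p.2} => (grpd M).mul p.1.1 p.1.2 p.2 := by
  classical
  rw [continuous_iff_continuousAt]
  rintro ⟨⟨a, b⟩, h⟩
  have h' : a.src = b.tgt := congrArg Prod.fst h
  have hk' : a.scal = b.scal := congrArg Prod.snd h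
  have c1 : Continuous fun p : {p : M.Secant × M.Secant // (grpd M).src p.1 = (grpd M).tgt p.2} =>
    p.1.1 := by fun_prop
  have c2 : Continuous fun p : {p : M.Secant × M.Secant // (grpd M).src p.1 = (grpd M).tgt p.2} =>
    p.1.2 := by fun_prop
  have hs := (continuous_src.comp c2).congr fun p => (mul_src p.1.1 p.1.2
    (congrArg Prod.fst p.2) (congrArg Prod.snd p.2)).symm
  have ht := (continuous_tgt.comp c1).congr fun p => (mul_tgt p.1.1 p.1.2
    (congrArg Prod.fst p.2) (congrArg Prod.snd p.2)).symm
  have hk := (continuous_scal.comp c2).congr fun p => (mul_scal p.1.1 p.1.2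
    (congrArg Prod.fst p.2) (congrArg Prod.snd p.2)).symm
  rcases exists_chart_or_of_composable a b h' hk' with ⟨e, h1, h2, h3⟩ | ⟨hK, h0⟩
  · refine continuousAt_of_chart (e := e) ((mul_src a b h' hk').symm ▸ h1)
      ((mul_tgt a b h' hk').symm ▸ h3) hs.continuousAt ht.continuousAt hk.continuousAt ?_
    have c3 := ((continuousAt_comp (h' ▸ h2) h3).comp_of_eq (c1.continuousAt (x := ⟨⟨a, b⟩, h⟩))
      rfl).add ((continuousAt_comp h1 h2).comp_of_eq (c2.continuousAt (x := ⟨⟨a, b⟩, h⟩)) rfl)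
    refine c3.congr ?_
    filter_upwards [(continuous_src.comp c2).continuousAt (e.1.open_source.mem_nhds h1),
      (continuous_tgt.comp c2).continuousAt (e.1.open_source.mem_nhds h2),
      (continuous_tgt.comp c1).continuousAt (e.1.open_source.mem_nhds h3)] with p p1 p2 p3
    exact (mul_comp p.1.1 p.1.2 (congrArg Prod.fst p.2) (congrArg Prod.snd p.2) p1 p2 p3).symm
  · exact continuousAt_of_ne_zero hK (by rwa [← mul_scal a b h' hk'] at h0) hs.continuousAt
      ht.continuousAt hk.continuousAt

variable (M) in
/-- The topological groupoid of secants. -/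
noncomputable def topGrpd : TopGrpd.{max u w} (M × K) where
  Mor := M.Secant
  grpd := grpd M
  continuous_src := continuous_src.prodMk continuous_scal
  continuous_tgt := continuous_tgt.prodMk continuous_scal
  continuous_one := continuous_zero
  continuous_inv := continuous_neg
  continuous_mul := continuous_mul

theorem ofChart_isFunctor (e : M.Charts) :
    (tangentGrpd K e.1.target).IsFunctor (grpd M) (ofChart e) (fun p => (e.1.symm p.1, p.2)) where
  src_map _ := rfl
  tgt_map _ := rfl
  one_map x := by
    have hx := e.1.map_target x.1.2
    refine ext_of_comp (e := e) rfl ?_ rfl hx hx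
      (ofChart_comp e ((tangentGrpd K e.1.target).one x)).symm
    show e.1.symm x.1.1 = e.1.symm (x.1.1 + x.2 • (0 : M.V))
    rw [smul_zero, add_zero]
  map_mul a b h := by
    have hb := ofChart_mem e b
    have ha := ofChart_mem e a
    have h' : (ofChart e a).src = (ofChart e b).tgt :=
      congrArg (fun p : e.1.target × K => e.1.symm p.1.1) h
    have hk' : (ofChart e a).scal = (ofChart e b).scal :=
      congrArg (Prod.snd : e.1.target × K → K) h
    refine (mul_eq (ofChart e a) (ofChart e b) h' hk'
      (m := ofChart e ((tangentGrpd K e.1.target).mul a b h)) rfl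
      (congrArg (fun p : e.1.target × K => e.1.symm p.1.1) ((tangentGrpd K e.1.target).tgt_mul a b h)) rfl
      (Or.inr ⟨e, hb.1, hb.2, ha.2, ?_⟩)).symm
    rw [ofChart_comp, ofChart_comp, ofChart_comp]
    rfl

/-! ### Rescaling -/

/-- Multiplication of the components by an invertible scalar. -/
def rescale (s : Kˣ) (a : M.Secant) : M.Secant where
  src := a.src
  tgt := a.tgt
  -- The inverse multiplies on the right, so that it cancels against the factor `s` of the
  -- component; this also makes rescaling a left action over a noncommutative ring.
  scal := a.scal * (s⁻¹ : Kˣ)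
  comp e := s • a.comp e
  isUnit_or := a.isUnit_or.imp_left fun h => h.mul s⁻¹.isUnit
  comp_eq_zero e he := by rw [a.comp_eq_zero e he, smul_zero]
  add_smul_comp e h1 h2 := by
    rw [← a.add_smul_comp e h1 h2, mul_smul, ← Units.smul_def, inv_smul_smul]
  chartSlope_comp e e' h1 h2 h3 h4 := by
    rw [← a.chartSlope_comp e e' h1 h2 h3 h4]
    exact slope_smul_scale (e.1.symm.trans e'.1).open_source (C1On_transition e e')
      (mem_extDomain_transition h1 h2 h3 h4 (a.add_smul_comp e h1 h2)) s

theorem rescale_one : rescale (1 : Kˣ) = (id : M.Secant → M.Secant) := by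
  funext a
  refine Secant.ext rfl rfl ?_ ?_ <;> simp [rescale]

theorem rescale_mul (s t : Kˣ) :
    rescale (s * t) = (rescale s ∘ rescale t : M.Secant → M.Secant) := by
  funext a
  refine Secant.ext rfl rfl ?_ ?_ <;> simp [rescale, mul_assoc, mul_smul]

theorem continuous_rescale (s : Kˣ) : Continuous (rescale s : M.Secant → M.Secant) := by
  classical
  rw [continuous_iff_continuousAt]
  intro a
  have hs : ContinuousAt (fun z : M.Secant => (rescale s z).src) a := continuous_src.continuousAt
  have ht : ContinuousAt (fun z : M.Secant => (rescale s z).tgt) a := continuous_tgt.continuousAt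
  have hk : ContinuousAt (fun z : M.Secant => (rescale s z).scal) a :=
    (continuous_scal.mul continuous_const).continuousAt
  rcases exists_chart_or_ne_zero (t := a.scal) {a.src, a.tgt} (by simp)
    (fun h => ⟨a.src, by simp [src_eq_tgt h]⟩) with ⟨e, he⟩ | ⟨hK, h0⟩
  · have h1 := he a.src (by simp)
    have h2 := he a.tgt (by simp)
    refine continuousAt_of_chart (e := e) h1 h2 hs ht hk ?_
    exact (continuousAt_comp h1 h2).const_smul (s : K)
  · exact continuousAt_of_ne_zero hK ((s⁻¹).isUnit.mul_left_eq_zero.not.2 h0) hs ht hk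

theorem rescale_isFunctor (s : Kˣ) :
    (grpd M).IsFunctor (grpd M) (rescale s) (fun p => (p.1, p.2 * (s⁻¹ : Kˣ))) where
  src_map _ := rfl
  tgt_map _ := rfl
  one_map x := Secant.ext rfl rfl rfl (funext fun _ => (smul_zero s).symm)
  map_mul a b h := by
    have h' : a.src = b.tgt := congrArg Prod.fst h
    have hk' : a.scal = b.scal := congrArg Prod.snd h
    refine (mul_eq (rescale s a) (rescale s b) h' (congrArg (· * _) hk')
      (m := rescale s (mul a b h' hk'))
      (mul_src a b h' hk') (mul_tgt a b h' hk') (congrArg (· * ((s⁻¹ : Kˣ) : K)) (mul_scal a b h' hk'))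
      ?_).symm
    rcases exists_chart_or_of_composable a b h' hk' with ⟨e, h1, h2, h3⟩ | ⟨hK, h0⟩
    · exact Or.inr ⟨e, h1, h2, h3,
        (congrArg (s • ·) (mul_comp a b h' hk' h1 h2 h3)).trans (smul_add ..)⟩
    · refine Or.inl (IsUnit.mul ?_ s⁻¹.isUnit)
      rw [← mul_scal a b h' hk'] at h0
      exact hK.2.1 _ h0

theorem rescale_ofChart (s : Kˣ) (e : M.Charts) (a a' : extDomain K e.1.target)
    (h : a'.1 = (a.1.1, s • a.1.2.1, a.1.2.2 * (s⁻¹ : Kˣ))) :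
    rescale s (ofChart e a) = ofChart e a' := by
  obtain ⟨⟨x, v, t⟩, ha⟩ := a
  obtain ⟨_, ha'⟩ := a'
  subst h
  refine ext_of_comp (e := e) rfl ?_ rfl (ofChart_mem e _).1 (ofChart_mem e _).2 ?_
  · show e.1.symm (x + t • v) = e.1.symm (x + (t * (s⁻¹ : Kˣ)) • s • v)
    rw [mul_smul, ← Units.smul_def, inv_smul_smul]
  · exact (congrArg (s • ·) (ofChart_comp e ⟨(x, v, t), ha⟩)).trans
      (ofChart_comp e ⟨(x, s • v, t * (s⁻¹ : Kˣ)), ha'⟩).symm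

end Secant
end HausdorffManifold

namespace HausdorffManifold

variable {K : Type w} [Ring K] [TopologicalSpace K] [IsGoodRing K]
variable {M N : HausdorffManifold.{u} K}

namespace Secant

/-! ### Functoriality -/

/-- The domain of the expression of a map in a pair of charts. -/
def mapDomain (f : M → N) (e : M.Charts) (e' : N.Charts) : Set M.V :=
  e.1.target ∩ e.1.symm ⁻¹' (f ⁻¹' e'.1.source)

theorem isOpen_mapDomain {f : M → N} (hf : Continuous f) (e : M.Charts) (e' : N.Charts) :
    IsOpen (mapDomain f e e') :=
  e.1.isOpen_inter_preimage_symm (e'.1.open_source.preimage hf)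

theorem mem_mapDomain {f : M → N} {e : M.Charts} {e' : N.Charts} {x : M}
    (hx : x ∈ e.1.source) (hx' : f x ∈ e'.1.source) : e.1 x ∈ mapDomain f e e' :=
  ⟨e.1.map_source hx, by rwa [mem_preimage, mem_preimage, e.1.left_inv hx]⟩

/-- The components of the image of a secant under a `C¹` map. -/
noncomputable def mapSlope (f : M → N) (e : M.Charts) (e' : N.Charts) : M.V × M.V × K → N.V :=
  slope K (e'.1 ∘ f ∘ e.1.symm) (mapDomain f e e')

theorem coord_mem_mapDomain {f : M → N} {e : M.Charts} {e' : N.Charts} {a : M.Secant}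
    (h1 : a.src ∈ e.1.source) (h2 : a.tgt ∈ e.1.source) (h1' : f a.src ∈ e'.1.source)
    (h2' : f a.tgt ∈ e'.1.source) :
    (e.1 a.src, a.comp e, a.scal) ∈ extDomain K (mapDomain f e e') := by
  refine ⟨mem_mapDomain h1 h1', ?_⟩
  simp only [a.add_smul_comp e h1 h2]
  exact mem_mapDomain h2 h2'

theorem add_smul_mapSlope {f : M → N} (hf : IsC1 f) {e : M.Charts} {e' : N.Charts}
    {a : M.Secant} (h1 : a.src ∈ e.1.source) (h2 : a.tgt ∈ e.1.source)
    (h1' : f a.src ∈ e'.1.source) (h2' : f a.tgt ∈ e'.1.source) :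
    e'.1 (f a.src) + a.scal • mapSlope f e e' (coord e a) = e'.1 (f a.tgt) := by
  have hc : ContinuousAt (e'.1 ∘ f ∘ e.1.symm) (e.1 a.src + a.scal • a.comp e) := by
    rw [a.add_smul_comp e h1 h2]
    refine ContinuousAt.comp_of_eq (e'.1.continuousAt h2') (ContinuousAt.comp_of_eq
      hf.1.continuousAt (e.1.symm.continuousAt (e.1.map_source h2)) (e.1.left_inv h2)) ?_
    simp [h2]
  have := add_smul_slope (isOpen_mapDomain hf.1 e e') (hf.2 e e')
    (coord_mem_mapDomain h1 h2 h1' h2') hc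
  simpa [mapSlope, coord, a.add_smul_comp e h1 h2, h1, h2] using this

/-- Both charts change, so the chain rule is used twice: `q1` changes the chart of N after the map,
`q2` the chart of M before it. -/
theorem chartSlope_mapSlope {f : M → N} (hf : IsC1 f) {e e₁ : M.Charts} {e' e₁' : N.Charts}
    {a : M.Secant} (h1 : a.src ∈ e.1.source) (h2 : a.tgt ∈ e.1.source)
    (h3 : a.src ∈ e₁.1.source) (h4 : a.tgt ∈ e₁.1.source)
    (h1' : f a.src ∈ e'.1.source) (h2' : f a.tgt ∈ e'.1.source)
    (h3' : f a.src ∈ e₁'.1.source) (h4' : f a.tgt ∈ e₁'.1.source) :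
    chartSlope e' e₁' (e'.1 (f a.src), mapSlope f e e' (coord e a), a.scal) =
      mapSlope f e₁ e₁' (coord e₁ a) := by
  have hs := add_smul_mapSlope hf h1 h2 h1' h2'
  have q1 : mapSlope f e e₁' (coord e a) =
      chartSlope e' e₁' (e'.1 (f a.src), mapSlope f e e' (coord e a), a.scal) := by
    have hm := mem_extDomain_transition h1' h2' h3' h4' hs
    have hx : (e'.1 ∘ f ∘ e.1.symm) (e.1 a.src) = e'.1 (f a.src) := by simp [h1]
    rw [← hx] at hm ⊢
    refine slope_comp (isOpen_mapDomain hf.1 e e') (e'.1.symm.trans e₁'.1).open_source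
      (isOpen_mapDomain hf.1 e e₁') (hf.2 e e') (C1On_transition e' e₁') (hf.2 e e₁')
      (fun z hz _ _ => ?_) (coord_mem_mapDomain h1 h2 h1' h2')
      (coord_mem_mapDomain h1 h2 h3' h4') hm
    simp only [Function.comp_apply]
    rw [e'.1.left_inv hz.2]
  have q2 : mapSlope f e e₁' (coord e a) = mapSlope f e₁ e₁' (coord e₁ a) := by
    have hm := coord_mem_mapDomain h3 h4 h3' h4'
    have hx : (e₁.1 ∘ e.1.symm) (e.1 a.src) = e₁.1 a.src := by simp [h1]
    rw [coord, coord]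
    rw [← a.chartSlope_comp e e₁ h1 h2 h3 h4, ← hx] at hm ⊢
    refine slope_comp (e.1.symm.trans e₁.1).open_source (isOpen_mapDomain hf.1 e₁ e₁')
      (isOpen_mapDomain hf.1 e e₁') (C1On_transition e e₁) (hf.2 e₁ e₁') (hf.2 e e₁')
      (fun z hz _ _ => ?_)
      (mem_extDomain_transition h1 h2 h3 h4 (a.add_smul_comp e h1 h2))
      (coord_mem_mapDomain h1 h2 h3' h4') hm
    rw [OpenPartialHomeomorph.trans_source] at hz
    simp only [Function.comp_apply]
    rw [e₁.1.left_inv hz.2]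
  rw [← q1, q2]

theorem exists_chart_or_map (f : M → N) (a : M.Secant) :
    (∃ (e : M.Charts) (e' : N.Charts), a.src ∈ e.1.source ∧ a.tgt ∈ e.1.source ∧
      f a.src ∈ e'.1.source ∧ f a.tgt ∈ e'.1.source) ∨ IsTopField K ∧ a.scal ≠ 0 := by
  classical
  rcases exists_chart_or_ne_zero (t := a.scal) {a.src, a.tgt} (by simp)
    (fun h => ⟨a.src, by simp [src_eq_tgt h]⟩) with ⟨e, he⟩ | h
  · rcases exists_chart_or_ne_zero (t := a.scal) {f a.src, f a.tgt} (by simp)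
      (fun h => ⟨f a.src, by simp [src_eq_tgt h]⟩) with ⟨e', he'⟩ | h
    · exact Or.inl ⟨e, e', he _ (by simp), he _ (by simp), he' _ (by simp), he' _ (by simp)⟩
    · exact Or.inr h
  · exact Or.inr h

/-- The slope of one chart expression of f gives the component, independently of the charts by
`chartSlope_mapSlope`. If charts are missing in M or in N, the scalar is invertible and the images
of the endpoints determine the secant. -/
theorem exists_map {f : M → N} (hf : IsC1 f) (a : M.Secant) :
    ∃ m : N.Secant, m.src = f a.src ∧ m.tgt = f a.tgt ∧ m.scal = a.scal ∧
      ∀ (e : M.Charts) (e' : N.Charts), a.src ∈ e.1.source → a.tgt ∈ e.1.source →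
        f a.src ∈ e'.1.source → f a.tgt ∈ e'.1.source →
          m.comp e' = mapSlope f e e' (coord e a) := by
  by_cases hc : ∃ (e : M.Charts) (e' : N.Charts), a.src ∈ e.1.source ∧ a.tgt ∈ e.1.source ∧
      f a.src ∈ e'.1.source ∧ f a.tgt ∈ e'.1.source
  · obtain ⟨e, e', h1, h2, h1', h2'⟩ := hc
    refine ⟨ofVec e' (f a.src) (f a.tgt) _ a.scal h1' h2' (add_smul_mapSlope hf h1 h2 h1' h2'),
      rfl, rfl, rfl, fun e₁ e₁' h3 h4 h3' h4' => ?_⟩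
    exact (if_pos ⟨h3', h4'⟩).trans (chartSlope_mapSlope hf h1 h2 h3 h4 h1' h2' h3' h4')
  · obtain ⟨hK, h0⟩ := (exists_chart_or_map f a).resolve_left hc
    obtain ⟨t, ht⟩ := hK.2.1 _ h0
    exact ⟨ofUnit (f a.src) (f a.tgt) t, rfl, rfl, ht,
      fun e e' h1 h2 h1' h2' => absurd ⟨e, e', h1, h2, h1', h2'⟩ hc⟩

/-- The map induced by a `C¹` map on secants. -/
noncomputable def map {f : M → N} (hf : IsC1 f) (a : M.Secant) : N.Secant :=
  (exists_map hf a).choose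

section
variable {f : M → N} (hf : IsC1 f) (a : M.Secant)

theorem map_src : (map hf a).src = f a.src := (exists_map hf a).choose_spec.1

theorem map_tgt : (map hf a).tgt = f a.tgt := (exists_map hf a).choose_spec.2.1

theorem map_scal : (map hf a).scal = a.scal := (exists_map hf a).choose_spec.2.2.1

theorem map_comp {e : M.Charts} {e' : N.Charts} (h1 : a.src ∈ e.1.source)
    (h2 : a.tgt ∈ e.1.source) (h1' : f a.src ∈ e'.1.source) (h2' : f a.tgt ∈ e'.1.source) :
    (map hf a).comp e' = mapSlope f e e' (coord e a) :=
  (exists_map hf a).choose_spec.2.2.2 e e' h1 h2 h1' h2'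

theorem continuous_map : Continuous (map hf) := by
  rw [continuous_iff_continuousAt]
  intro a
  have hs := ((hf.1.comp continuous_src).congr fun a => (map_src hf a).symm).continuousAt (x := a)
  have ht := ((hf.1.comp continuous_tgt).congr fun a => (map_tgt hf a).symm).continuousAt (x := a)
  have hk := (continuous_scal.congr fun a => (map_scal hf a).symm).continuousAt (x := a)
  rcases exists_chart_or_map f a with ⟨e, e', h1, h2, h1', h2'⟩ | ⟨hK, h0⟩
  · refine continuousAt_of_chart (e := e') (by rwa [map_src]) (by rwa [map_tgt]) hs ht hk ?_
    have hc : ContinuousAt (mapSlope f e e' ∘ coord e) a :=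
      (slope_continuousAt (isOpen_mapDomain hf.1 e e') (hf.2 e e')
        (coord_mem_mapDomain h1 h2 h1' h2')).comp_of_eq (continuousAt_coord h1 h2) rfl
    refine hc.congr ?_
    filter_upwards [overChart_mem_nhds h1 h2,
      (hf.1.comp continuous_src).continuousAt (e'.1.open_source.mem_nhds h1'),
      (hf.1.comp continuous_tgt).continuousAt (e'.1.open_source.mem_nhds h2')] with b h h3 h4
    exact (map_comp hf b h.1 h.2 h3 h4).symm
  · exact continuousAt_of_ne_zero hK (by rwa [map_scal]) hs ht hk

theorem map_isFunctor : (grpd M).IsFunctor (grpd N) (map hf) (Prod.map f id) where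
  src_map a := Prod.ext (map_src hf a) (map_scal hf a)
  tgt_map a := Prod.ext (map_tgt hf a) (map_scal hf a)
  one_map x := by
    obtain ⟨e, he⟩ := exists_chart x.1
    obtain ⟨e', he'⟩ := exists_chart (f x.1)
    refine ext_of_comp (e := e') (map_src hf (zero x.1 x.2)).symm (map_tgt hf (zero x.1 x.2)).symm
      (map_scal hf (zero x.1 x.2)).symm he' he' ?_
    refine Eq.trans ?_ (map_comp hf (zero x.1 x.2) he he he' he').symm
    exact (slope_zero (isOpen_mapDomain hf.1 e e') (hf.2 e e') (mem_mapDomain he he')).symm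
  map_mul a b h := by
    have h' : a.src = b.tgt := congrArg Prod.fst h
    have hk' : a.scal = b.scal := congrArg Prod.snd h
    have gs : (map hf a).src = (map hf b).tgt := by rw [map_src, map_tgt, h']
    have gk : (map hf a).scal = (map hf b).scal := by rw [map_scal, map_scal, hk']
    refine (mul_eq (map hf a) (map hf b) gs gk (m := map hf (mul a b h' hk')) ?_ ?_ ?_ ?_).symm
    · rw [map_src, map_src, mul_src]
    · rw [map_tgt, map_tgt, mul_tgt]
    · rw [map_scal, map_scal, mul_scal]
    -- A common chart may be missing for the three points in M or for their images in N; in either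
    -- case this settles the matter. Otherwise the claim is additivity of the slope of f in charts.
    have hu : IsTopField K ∧ b.scal ≠ 0 → IsUnit (map hf (mul a b h' hk')).scal := fun hu => by
      rw [map_scal, mul_scal]; exact hu.1.2.1 _ hu.2
    rcases exists_chart_or_of_composable a b h' hk' with ⟨e, h1, h2, h3⟩ | hu'
    swap
    · exact Or.inl (hu hu')
    rcases exists_chart_or_of_composable (map hf a) (map hf b) gs gk with ⟨e', g1, g2, g3⟩ | hu'
    swap
    · exact Or.inl (hu (by rwa [map_scal] at hu'))
    refine Or.inr ⟨e', g1, g2, g3, ?_⟩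
    rw [map_src] at g1
    rw [map_tgt] at g2 g3
    rw [map_comp hf a (h' ▸ h2) h3 (h' ▸ g2) g3, map_comp hf b h1 h2 g1 g2,
      map_comp hf (mul a b h' hk') (e := e) (by rwa [mul_src]) (by rwa [mul_tgt])
        (by rwa [mul_src]) (by rwa [mul_tgt]), coord, coord, coord, mul_src, mul_scal,
      mul_comp a b h' hk' h1 h2 h3]
    have hm := coord_mem_mapDomain (f := f) (a := a) (h' ▸ h2) h3 (h' ▸ g2) g3
    rw [h', hk', ← b.add_smul_comp e h1 h2] at hm ⊢
    exact slope_add (isOpen_mapDomain hf.1 e e') (hf.2 e e')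
      (coord_mem_mapDomain h1 h2 g1 g2) hm

end

section
variable {f : M → N} {F F' : M.Secant → N.Secant}

/-- The component of `F` in charts is continuous, and for invertible scalars the endpoints force it
to be the difference quotient of f. Only continuity and the compatibility with source and target
enter. -/
theorem isC1_of_isFunctor (hF : Continuous F)
    (h : (grpd M).IsFunctor (grpd N) F (Prod.map f id)) : IsC1 f := by
  have hs : ∀ a, (F a).src = f a.src := fun a => congrArg Prod.fst (h.src_map a)
  have ht : ∀ a, (F a).tgt = f a.tgt := fun a => congrArg Prod.fst (h.tgt_map a)
  have hk : ∀ a, (F a).scal = a.scal := fun a => congrArg Prod.snd (h.src_map a)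
  refine ⟨?_, fun e e' => ?_⟩
  -- Continuity of f: embed M by zero secants, apply `F` and take the source.
  · have : Continuous fun x : M => zero x (0 : K) := 
      continuous_zero.comp (continuous_id.prodMk continuous_const)
    exact (continuous_src.comp (hF.comp this)).congr fun x => hs _
  · classical
    have hsub : extDomain K (mapDomain f e e') ⊆ extDomain K e.1.target :=
      fun p hp => ⟨hp.1.1, hp.2.1⟩
    -- The value 0 off the extended domain is irrelevant, since continuity is required only on that
    -- domain.
    obtain ⟨g, hg⟩ : ∃ g : M.V × M.V × K → N.V, ∀ p (hp : p ∈ extDomain K (mapDomain f e e')),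
        g p = (F (ofChart e ⟨p, hsub hp⟩)).comp e' :=
      ⟨fun p => if hp : p ∈ extDomain K (mapDomain f e e') then
        (F (ofChart e ⟨p, hsub hp⟩)).comp e' else 0, fun p hp => dif_pos hp⟩
    refine ⟨g, ?_, fun x v t hp => ?_⟩
    · change ContinuousOn _ (extDomain K (mapDomain f e e'))
      rw [continuousOn_iff_continuous_domRestrict]
      have hc : Continuous fun p : extDomain K (mapDomain f e e') =>
          F (ofChart e ⟨p.1, hsub p.2⟩) :=
        hF.comp ((continuous_ofChart e).comp (by fun_prop))
      have hc' : Continuous fun p : extDomain K (mapDomain f e e') =>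
          (F (ofChart e ⟨p.1, hsub p.2⟩)).comp e' := by
        rw [continuous_iff_continuousAt]
        intro p
        refine ContinuousAt.comp_of_eq (continuousAt_comp ?_ ?_) hc.continuousAt rfl
        · rw [hs]; exact p.2.1.2
        · rw [ht]; exact p.2.2.2
      exact hc'.congr fun p => (hg p.1 p.2).symm
    · change (x, v, (t : K)) ∈ extDomain K (mapDomain f e e') at hp
      rw [hg _ hp, comp_eq_of_units _ (hk _), hs, ht]
      · rfl
      · rw [hs]; exact hp.1.2
      · rw [ht]; exact hp.2.2

/-- Endpoints and scalars of the images are prescribed, which is enough on the dense set of secants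
with invertible scalar; the target is Hausdorff. -/
theorem functor_unique (hF : Continuous F) (h : (grpd M).IsFunctor (grpd N) F (Prod.map f id))
    (hF' : Continuous F') (h' : (grpd M).IsFunctor (grpd N) F' (Prod.map f id)) : F = F' := by
  refine funext_of_isUnit hF hF' fun a ha => ext_of_isUnit ?_ ?_ ?_ ?_
  · exact congrArg Prod.fst ((h.src_map a).trans (h'.src_map a).symm)
  · exact congrArg Prod.fst ((h.tgt_map a).trans (h'.tgt_map a).symm)
  · exact congrArg Prod.snd ((h.src_map a).trans (h'.src_map a).symm)
  · rwa [show (F a).scal = a.scal from congrArg Prod.snd (h.src_map a)]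

theorem functor_comp_rescale (hF : Continuous F)
    (h : (grpd M).IsFunctor (grpd N) F (Prod.map f id)) (s : Kˣ) :
    F ∘ rescale s = rescale s ∘ F := by
  have hs : ∀ a, (F a).src = f a.src := fun a => congrArg Prod.fst (h.src_map a)
  have ht : ∀ a, (F a).tgt = f a.tgt := fun a => congrArg Prod.fst (h.tgt_map a)
  have hk : ∀ a, (F a).scal = a.scal := fun a => congrArg Prod.snd (h.src_map a)
  refine funext_of_isUnit (hF.comp (continuous_rescale s)) ((continuous_rescale s).comp hF)
    fun a ha => ext_of_isUnit ?_ ?_ ?_ ?_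
  · exact (hs _).trans (hs a).symm
  · exact (ht _).trans (ht a).symm
  · exact (hk _).trans (congrArg (· * ((s⁻¹ : Kˣ) : K)) (hk a).symm)
  · rw [Function.comp_apply, hk]
    exact ha.mul s⁻¹.isUnit

end

/-! ### Slices -/

theorem slice_units_isIsoOver (t : Kˣ) : ((grpd M).slice (t : K)).IsIsoOver (pairGrpd M) :=
  ⟨{ toFun := fun a => (a.1.tgt, a.1.src)
     invFun := fun p => ⟨ofUnit p.2 p.1 t, rfl, rfl⟩
     left_inv := fun a => Subtype.ext (ofUnit_eq a.2.1)
     right_inv := fun _ => rfl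
     continuous_toFun := (continuous_tgt.comp continuous_subtype_val).prodMk
       (continuous_src.comp continuous_subtype_val)
     continuous_invFun := (continuous_ofUnit.comp
       (continuous_snd.prodMk (continuous_fst.prodMk continuous_const))).subtype_mk _ },
   { src_map := fun _ => rfl
     tgt_map := fun _ => rfl
     one_map := fun _ => rfl
     map_mul := fun _ _ _ => Prod.ext (mul_tgt ..) (mul_src ..) }⟩

/-- The tangent vector given by a secant for the scalar zero. -/
def toTangentVec (a : M.Secant) (h : a.scal = 0) : M.TangentVec :=
  ⟨(a.src, a.comp), fun e he => a.comp_eq_zero e fun h' => he h'.1, fun e e' he he' => by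
    have hst := src_eq_tgt h
    have hc := a.chartSlope_comp e e' he (hst ▸ he) he' (hst ▸ he')
    rw [h] at hc
    show HasDirDeriv K _ _ _ (a.comp e')
    rw [← hc]
    exact hasDirDeriv_slope (e.1.symm.trans e'.1).open_source (C1On_transition e e') _
      (mem_transition_source he he')⟩

/-- A tangent vector as a secant for the scalar zero. -/
def ofTangentVec (p : M.TangentVec) : M.Secant where
  src := p.1.1
  tgt := p.1.1
  scal := 0
  comp := p.1.2
  isUnit_or := Or.inr ((exists_chart p.1.1).imp fun _ h => ⟨h, h⟩)
  comp_eq_zero e he := p.2.1 e fun h => he ⟨h, h⟩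
  add_smul_comp _ _ _ := by rw [zero_smul, add_zero]
  chartSlope_comp e e' h1 _ h3 _ := (hasDirDeriv_slope (e.1.symm.trans e'.1).open_source
    (C1On_transition e e') _ (mem_transition_source h1 h3)).unique (p.2.2 e e' h1 h3)

theorem isOpen_tangentVec (e : M.Charts) {O : Set (M.V × M.V)} (hO : IsOpen O) :
    IsOpen {p : M.TangentVec | p.1.1 ∈ e.1.source ∧ (e.1 p.1.1, p.1.2 e) ∈ O} :=
  TopologicalSpace.isOpen_generateFrom_of_mem ⟨e, O, hO, rfl⟩

theorem continuousAt_tangentVec_coord {e : M.Charts} {p : M.TangentVec}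
    (hp : p.1.1 ∈ e.1.source) :
    ContinuousAt (fun p : M.TangentVec => (e.1 p.1.1, p.1.2 e)) p := by
  rw [ContinuousAt, (nhds_basis_opens _).tendsto_right_iff]
  rintro O ⟨h, hO⟩
  filter_upwards [(isOpen_tangentVec e hO).mem_nhds ⟨hp, h⟩] with q hq
  exact hq.2

theorem continuous_tangentVec_base : Continuous fun p : M.TangentVec => p.1.1 := by
  rw [continuous_iff_continuousAt]
  intro p
  obtain ⟨e, he⟩ := exists_chart p.1.1
  have hc : ContinuousAt (fun p : M.TangentVec => e.1.symm (e.1 p.1.1)) p :=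
    (e.1.symm.continuousAt (e.1.map_source he)).comp_of_eq
      (continuousAt_tangentVec_coord he).fst rfl
  refine hc.congr ?_
  filter_upwards [(isOpen_tangentVec e isOpen_univ).mem_nhds ⟨he, mem_univ _⟩] with q hq
  exact e.1.left_inv hq.1

theorem continuous_ofTangentVec : Continuous (ofTangentVec : M.TangentVec → M.Secant) := by
  rw [continuous_iff_continuousAt]
  intro p
  obtain ⟨e, he⟩ := exists_chart p.1.1
  exact continuousAt_of_chart (e := e) he he continuous_tangentVec_base.continuousAt
    continuous_tangentVec_base.continuousAt continuousAt_const
    (continuousAt_tangentVec_coord he).snd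

/-- At scalar 0 the endpoints coincide and the slope of a transition map is its directional
derivative, so both sides consist of the same families of components with the same zero convention.
Both topologies are described by base point and component in a chart. -/
theorem slice_zero_isIsoOver : ((grpd M).slice (0 : K)).IsIsoOver M.tangentBundle :=
  ⟨{ toFun := fun a => toTangentVec a.1 a.2.1
     invFun := fun p => ⟨ofTangentVec p, rfl, rfl⟩
     left_inv := fun a => Subtype.ext (Secant.ext rfl (src_eq_tgt a.2.1) a.2.1.symm rfl)
     right_inv := fun _ => rfl
     continuous_toFun := by
       refine continuous_generateFrom_iff.2 ?_
       rintro _ ⟨e, O, hO, rfl⟩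
       rw [isOpen_iff_mem_nhds]
       rintro ⟨a, ha⟩ ⟨h1, h2⟩
       change a.src ∈ e.1.source at h1
       have hc : ContinuousAt (fun a : M.Secant => (e.1 a.src, a.comp e)) a :=
         ((e.1.continuousAt h1).comp continuous_src.continuousAt).prodMk
           (continuousAt_comp h1 (src_eq_tgt ha.1 ▸ h1))
       have hmem : {a : M.Secant | a.src ∈ e.1.source ∧ (e.1 a.src, a.comp e) ∈ O} ∈ 𝓝 a :=
         inter_mem (continuous_src.continuousAt (e.1.open_source.mem_nhds h1))
           (hc (hO.mem_nhds h2))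
       exact continuousAt_subtype_val (x := ⟨a, ha⟩) hmem
     continuous_invFun := continuous_ofTangentVec.subtype_mk _ },
   { src_map := fun _ => rfl
     tgt_map := fun a => src_eq_tgt a.2.1
     one_map := fun _ => rfl
     map_mul := fun a b h => by
       have h' : a.1.src = b.1.tgt := h
       have hk' : a.1.scal = b.1.scal := a.2.1.trans b.2.1.symm
       have hb := src_eq_tgt b.2.1
       refine Subtype.ext (Prod.ext (mul_src a.1 b.1 h' hk') (funext fun e => ?_))
       change (mul a.1 b.1 h' hk').comp e = a.1.comp e + b.1.comp e
       -- The product is known to add components only in charts around the base point; in the others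
       -- all three components are 0.
       by_cases he : b.1.src ∈ e.1.source
       · exact mul_comp a.1 b.1 h' hk' he (hb ▸ he) (by rw [← src_eq_tgt a.2.1, h', ← hb]; exact he)
       · rw [comp_eq_zero _ e fun h => he (by simpa only [mul_src] using h.1),
           a.1.comp_eq_zero e fun h => he (by rw [hb, ← h']; exact h.1),
           b.1.comp_eq_zero e fun h => he h.1, add_zero] }⟩

end Secant
end HausdorffManifold

namespace HausdorffManifold
namespace Secant

/-! ### Open subsets of modules -/

section OfOpen

variable {K : Type w} [Ring K] [TopologicalSpace K] [IsGoodRing K]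
variable {V : Type u} [AddCommGroup V] [Module K V] [TopologicalSpace V]
  [IsTopologicalAddGroup V] [ContinuousSMul K V] [T2Space V] {U : Set V}

variable (K) in
/-- The only chart of an open subset of a module. -/
noncomputable def inclusionChart (hU : IsOpen U) (hne : Nonempty U) :
    (ofOpen (K := K) U hU).Charts :=
  ⟨(hU.isOpenEmbedding_subtypeVal.toOpenPartialHomeomorph (Subtype.val : U → V) :
    OpenPartialHomeomorph U V), hne, rfl⟩

theorem mem_inclusionChart_source (hU : IsOpen U) (hne : Nonempty U)
    (x : ofOpen (K := K) U hU) : x ∈ (inclusionChart K hU hne).1.source := mem_univ _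

/-- The inclusion is a chart around all points at once, so its coordinates are global on the space
of secants. -/
theorem ofOpen_isIsoOver (hU : IsOpen U) :
    (grpd (ofOpen (K := K) U hU)).IsIsoOver (tangentGrpd K U) := by
  by_cases hne : Nonempty U
  · let e := inclusionChart K hU hne
    have hm : ∀ x, x ∈ e.1.source := mem_inclusionChart_source hU hne
    have hmem : ∀ a : (ofOpen (K := K) U hU).Secant, coord e a ∈ extDomain K U := fun a =>
      ⟨Subtype.property (p := (· ∈ U)) a.src, by
        show e.1 a.src + a.scal • a.comp e ∈ U
        rw [a.add_smul_comp e (hm _) (hm _)]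
        exact Subtype.property (p := (· ∈ U)) a.tgt⟩
    refine ⟨{ toFun := fun a => ⟨coord e a, hmem a⟩
              invFun := fun p => ofVec e (⟨p.1.1, p.2.1⟩ : U)
                (⟨p.1.1 + p.1.2.2 • p.1.2.1, p.2.2⟩ : U) p.1.2.1 p.1.2.2 (hm _) (hm _) rfl
              left_inv := fun a => ?_
              right_inv := fun p => ?_
              continuous_toFun := ?_
              continuous_invFun := ?_ }, ?_⟩
    · exact ext_of_comp (e := e) rfl (Subtype.ext (a.add_smul_comp e (hm _) (hm _))) rfl (hm _)
        (hm _) (ofVec_comp (hm _) (hm _) _)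
    · exact Subtype.ext (Prod.ext rfl (Prod.ext (ofVec_comp (hm _) (hm _) rfl) rfl))
    · refine Continuous.subtype_mk ?_ _
      exact continuous_iff_continuousAt.2 fun a => continuousAt_coord (hm _) (hm _)
    · have c1 : Continuous fun p : extDomain K U => p.1.1 := by fun_prop
      have c2 : Continuous fun p : extDomain K U => p.1.1 + p.1.2.2 • p.1.2.1 := by fun_prop
      have c3 : Continuous fun p : extDomain K U => p.1.2.1 := by fun_prop
      have c4 : Continuous fun p : extDomain K U => p.1.2.2 := by fun_prop
      rw [continuous_iff_continuousAt]
      intro p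
      refine continuousAt_of_chart (e := e) (hm _) (hm _) ?_ ?_ ?_ ?_
      · exact (c1.subtype_mk _).continuousAt
      · exact (c2.subtype_mk _).continuousAt
      · exact c4.continuousAt
      · exact (c3.congr fun p => (ofVec_comp (hm _) (hm _) _).symm).continuousAt
    · exact
      { src_map := fun a => rfl
        tgt_map := fun a => Prod.ext (Subtype.ext (a.add_smul_comp e (hm _) (hm _))) rfl
        one_map := fun x => rfl
        map_mul := fun a b h => by
          have h' : a.src = b.tgt := congrArg Prod.fst h
          have hk' : a.scal = b.scal := congrArg Prod.snd h
          exact Subtype.ext (Prod.ext (congrArg e.1 (mul_src a b h' hk'))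
            (Prod.ext (mul_comp a b h' hk' (hm _) (hm _) (hm _)) (mul_scal a b h' hk'))) }
  -- For empty U the atlas is empty, so there is no chart to use, but both spaces of morphisms are
  -- empty.
  · have h1 : IsEmpty U := not_nonempty_iff.1 hne
    have h2 : IsEmpty (ofOpen (K := K) U hU).Secant := ⟨fun a => h1.false a.src⟩
    have h3 : IsEmpty (extDomain K U) := ⟨fun p => h1.false ⟨p.1.1, p.2.1⟩⟩
    exact ⟨Homeomorph.empty,
      { src_map := fun a => isEmptyElim a
        tgt_map := fun a => isEmptyElim a
        one_map := fun x => h1.elim x.1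
        map_mul := fun a => isEmptyElim a }⟩

end OfOpen

end Secant
end HausdorffManifold
end LieCalc

/-! ### The tangent groupoid of a manifold: the main theorem -/

theorem theorem3p1 {K : Type w} [Ring K] [TopologicalSpace K] [LieCalc.IsGoodRing K] :
    ∃ (T : ∀ M : LieCalc.HausdorffManifold.{u} K, LieCalc.TopGrpd.{max u w} (M × K))
      (ι : ∀ (M : LieCalc.HausdorffManifold.{u} K) (e : M.Charts),
        LieCalc.extDomain K e.1.target → (T M).Mor)
      (Φ : ∀ M : LieCalc.HausdorffManifold.{u} K, Kˣ → (T M).Mor → (T M).Mor),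
      -- every morphism stays in one slice
      (∀ (M : LieCalc.HausdorffManifold.{u} K) (a : (T M).Mor),
        ((T M).grpd.src a).2 = ((T M).grpd.tgt a).2) ∧
      -- over a chart domain, the groupoid is the tangent groupoid of the chart image
      (∀ (M : LieCalc.HausdorffManifold.{u} K) (e : M.Charts),
        Topology.IsOpenEmbedding (ι M e) ∧
        (LieCalc.tangentGrpd K e.1.target).IsFunctor (T M).grpd (ι M e)
          (fun p => (e.1.symm p.1, p.2)) ∧
        Set.range (ι M e) = {a | ((T M).grpd.src a).1 ∈ e.1.source ∧
          ((T M).grpd.tgt a).1 ∈ e.1.source}) ∧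
      -- agreement with the tangent groupoid of an open subset of a topological module
      (∀ (V : Type u) [AddCommGroup V] [Module K V] [TopologicalSpace V]
        [IsTopologicalAddGroup V] [ContinuousSMul K V] [T2Space V] (U : Set V) (hU : IsOpen U),
        (T (LieCalc.HausdorffManifold.ofOpen U hU)).grpd.IsIsoOver (LieCalc.tangentGrpd K U)) ∧
      -- smooth maps correspond to continuous functors
      (∀ (M N : LieCalc.HausdorffManifold.{u} K) (f : M → N),
        (LieCalc.HausdorffManifold.IsC1 f ↔
          ∃ F, LieCalc.HausdorffManifold.IsContFunctorOver (T M) (T N) f F) ∧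
        ∀ F F', LieCalc.HausdorffManifold.IsContFunctorOver (T M) (T N) f F →
          LieCalc.HausdorffManifold.IsContFunctorOver (T M) (T N) f F' → F = F') ∧
      -- slices
      (∀ (M : LieCalc.HausdorffManifold.{u} K) (t : Kˣ),
        ((T M).grpd.slice (t : K)).IsIsoOver (LieCalc.pairGrpd M)) ∧
      (∀ M : LieCalc.HausdorffManifold.{u} K,
        ((T M).grpd.slice (0 : K)).IsIsoOver M.tangentBundle) ∧
      -- the action of the unit group by automorphisms
      (∀ M : LieCalc.HausdorffManifold.{u} K,
        Φ M 1 = id ∧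
        (∀ s t : Kˣ, Φ M (s * t) = Φ M s ∘ Φ M t) ∧
        ∀ s : Kˣ, Continuous (Φ M s) ∧
          (T M).grpd.IsFunctor (T M).grpd (Φ M s) (fun p => (p.1, p.2 * (s⁻¹ : Kˣ))) ∧
          ∀ (e : M.Charts) (a a' : LieCalc.extDomain K e.1.target),
            a'.1 = (a.1.1, s • a.1.2.1, a.1.2.2 * (s⁻¹ : Kˣ)) →
              Φ M s (ι M e a) = ι M e a') ∧
      -- it commutes with the functors attached to smooth maps
      (∀ (M N : LieCalc.HausdorffManifold.{u} K) (f : M → N) (F : (T M).Mor → (T N).Mor),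
        LieCalc.HausdorffManifold.IsContFunctorOver (T M) (T N) f F →
          ∀ s : Kˣ, F ∘ Φ M s = Φ N s ∘ F) := by
  refine ⟨LieCalc.HausdorffManifold.Secant.topGrpd,
    fun M => LieCalc.HausdorffManifold.Secant.ofChart,
    fun M => LieCalc.HausdorffManifold.Secant.rescale, fun M a => rfl, fun M e => ?_, ?_, ?_, ?_,
    ?_, fun M => ?_, ?_⟩
  · exact ⟨LieCalc.HausdorffManifold.Secant.isOpenEmbedding_ofChart e,
      LieCalc.HausdorffManifold.Secant.ofChart_isFunctor e,
      LieCalc.HausdorffManifold.Secant.range_ofChart e⟩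
  · intro V _ _ _ _ _ _ U hU
    exact LieCalc.HausdorffManifold.Secant.ofOpen_isIsoOver hU
  · intro M N f
    refine ⟨⟨fun hf => ⟨LieCalc.HausdorffManifold.Secant.map hf,
      LieCalc.HausdorffManifold.Secant.continuous_map hf,
      LieCalc.HausdorffManifold.Secant.map_isFunctor hf⟩, fun ⟨F, hF⟩ =>
      LieCalc.HausdorffManifold.Secant.isC1_of_isFunctor hF.1 hF.2⟩, fun F F' hF hF' =>
      LieCalc.HausdorffManifold.Secant.functor_unique hF.1 hF.2 hF'.1 hF'.2⟩
  · exact fun M t => LieCalc.HausdorffManifold.Secant.slice_units_isIsoOver t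
  · exact fun M => LieCalc.HausdorffManifold.Secant.slice_zero_isIsoOver
  · exact ⟨LieCalc.HausdorffManifold.Secant.rescale_one,
      LieCalc.HausdorffManifold.Secant.rescale_mul, fun s =>
      ⟨LieCalc.HausdorffManifold.Secant.continuous_rescale s,
        LieCalc.HausdorffManifold.Secant.rescale_isFunctor s,
        LieCalc.HausdorffManifold.Secant.rescale_ofChart s⟩⟩
  · exact fun M N f F hF s =>
      LieCalc.HausdorffManifold.Secant.functor_comp_rescale hF.1 hF.2 s
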